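/- **Conventions.** $\mathbb N=\{1,2,\dots\}$; $[M]^{<\omega}$ and $[M]^{\omega}$ are the finite and the infinite subsets of $M\subset\mathbb N$; $\min\emptyset=\infty$; $A<B$ means $\max A<\min B$; $A\preceq B$ means that $A$ is an initial segment of $B$; $\mathrm{MAX}(\mathcal F)$ is the set of $\preceq$-maximal members of $\mathcal F\subset[\mathbb N]^{<\omega}$. **Schreier families.** For each countable limit ordinal $\alpha$ fix a nondecreasing sequence $(\lambda(\alpha,n))_{n\in\mathbb N}\subset[1,\alpha)$ with supremum $\alpha$, and put $\mathcal S_0=\{\emptyset\}\cup\{\{n\}:n\in\mathbb N\}$, $$\mathcal S_{\gamma+1}=\{\emptyset\}\cup\Big\{\bigcup_{j=1}^nE_j:\ E_1<\dots<E_n,\ \emptyset\ne E_j\in\mathcal S_\gamma,\ 1\le n\le\min E_1\Big\},\qquad \mathcal S_\alpha=\{E:\ \exists k\le\min E,\ E\in\mathcal S_{\lambda(\alpha,k)}\}$$ for $\gamma<\omega_1$ and countable limit ordinals $\alpha$. The sequences are chosen so that (a) $\lambda(\gamma+\omega^{\xi},n)=\gamma+\lambda(\omega^\xi,n)$ for all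 $n$ whenever $1\le\xi<\omega_1$ and $0<\gamma<\omega_1$ has only exponents $\ge\xi$ in its Cantor normal form, and (b) $\mathcal S_{\lambda(\omega^\xi,n)}\subset\mathcal S_{\lambda(\omega^\xi,n+1)}$ for all $n$ and $1\le\xi<\omega_1$. **Repeated averages.** For $A\in\mathrm{MAX}(\mathcal S_\alpha)$ define $z_{(\alpha,A)}:\mathbb N\to[0,1]$ recursively. Let $z_{(0,\{n\})}$ be the indicator function of $\{n\}$. If $A\in\mathrm{MAX}(\mathcal S_{\gamma+1})$, write $A=A_1\cup\dots\cup A_n$ (uniquely) with $n=\min A$ and $A_1<\dots<A_n$ in $\mathrm{MAX}(\mathcal S_\gamma)$, and put $z_{(\gamma+1,A)}=\frac1n\sum_{j=1}^nz_{(\gamma,A_j)}$. For a limit ordinal $\alpha$ put $z_{(\alpha,A)}=z_{(\lambda(\alpha,\min A),A)}$. For $\emptyset\ne A\in\mathcal S_\alpha$ let $\zeta(\alpha,A)=z_{(\alpha,B)}(\max A)$, where $B\in\mathrm{MAX}(\mathcal S_\alpha)$ is any extension of $A$ (the value does not depend on $B$). **Szlenk index.** For a Banach space $X$, $K\subset X^*$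 and $\varepsilon>0$ let $K'_\varepsilon$ be the set of all $x^*\in X^*$ for which there is a sequence $(x_n^*)\subset K$ that converges weak$^*$ to $x^*$ with $\|x^*_n-x^*\|>\varepsilon$ for all $n$. Put $K^{(0)}_\varepsilon=K$, $K^{(\beta+1)}_\varepsilon=(K^{(\beta)}_\varepsilon)'_\varepsilon$, and $K^{(\beta)}_\varepsilon=\bigcap_{\gamma<\beta}K^{(\gamma)}_\varepsilon$ for limit ordinals $\beta$. Then $\mathrm{Sz}(X)=\sup_{\varepsilon>0}\sup\{\beta<\omega_1:(B_{X^*})^{(\beta)}_\varepsilon\neq\emptyset\}$, where $B_{X^*}$ is the closed unit ball. **FDDs.** An FDD of $X$ is a sequence $(F_j)_{j\in\mathbb N}$ of finite-dimensional subspaces such that every $x\in X$ has a unique representation $x=\sum_{j=1}^\infty x_j$ (norm convergence) with $x_j\in F_j$. Then $\mathrm{supp}(x)=\{j:x_j\ne0\}$, and $\mathrm{ran}(x)$ is the smallest interval of $\mathbb N$ containing $\mathrm{supp}(x)$. The FDD is shrinking if every bounded sequence $(x_n)_{n=1}^\infty$ of nonzero vectors with $\mathrm{supp}(x_1)<\mathrm{supp}(x_2)<\dots$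 is weakly null. **Theorem 7.1.** Let $X$ be a real or complex Banach space with a shrinking FDD, and let $\alpha$ be a countable ordinal with $\mathrm{Sz}(X)\le\omega^\alpha$; if $\alpha=0$, assume that $X$ is infinite-dimensional. Then for every $\varepsilon>0$ and $M\in[\mathbb N]^\omega$ there is $N\in[M]^\omega$ such that for every $B=\{b_1<\dots<b_d\}\in\mathcal S_\alpha\cap[N]^{<\omega}$ and all $x_1,\dots,x_d$ in the closed unit ball of $X$ with $\mathrm{ran}(x_j)\subset(b_{j-1},b_{j+1})$ for $j=1,\dots,d$ (where $b_0=0$ and $b_{d+1}=\infty$), one has $$\Big\|\sum_{j=1}^d\zeta(\alpha,\{b_1,\dots,b_j\})\,x_j\Big\|<\varepsilon .$$ -/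

import Mathlib

open Filter Topology Ordinal

noncomputable section

/-! Finite subsets of `ℕ = {1, 2, …}`. -/

/-- `A < B`, i.e. `max A < min B`; true if `A` or `B` is empty. -/
def SetLT (A B : Finset ℕ+) : Prop := ∀ a ∈ A, ∀ b ∈ B, a < b

/-- `A ≼ B`: the set `A` is an initial segment of `B`. -/
def IsInitialSegment (A B : Finset ℕ+) : Prop :=
  A ⊆ B ∧ ∀ a ∈ A, ∀ b ∈ B, b ≤ a → b ∈ A

/-- `MAX(𝓕)`: the members of `𝓕` without proper extension in `𝓕`. -/
def maximalSets (𝓕 : Set (Finset ℕ+)) : Set (Finset ℕ+) :=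
  {A | A ∈ 𝓕 ∧ ∀ B ∈ 𝓕, IsInitialSegment A B → B = A}

/-- `E = P₁ ∪ … ∪ Pₙ` with `P₁ < … < Pₙ` nonempty. -/
def IsSuccessiveUnion {n : ℕ} (P : Fin n → Finset ℕ+) (E : Finset ℕ+) : Prop :=
  (∀ j, (P j).Nonempty) ∧ (∀ i j, i < j → SetLT (P i) (P j)) ∧ E = Finset.univ.biUnion P

/-! Schreier families; `lam α n` is the approximating sequence of the limit ordinal `α`. -/

/-- The Schreier family `S_α` built from the approximating sequences `lam`.
* `S_0` consists of `∅` and the singletons;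
* `S_{γ+1}` consists of all `E₁ ∪ … ∪ Eₙ` with `E₁ < … < Eₙ` nonempty in `S_γ`, `n ≤ min E₁`
  (`n = 0` gives `∅`);
* for a limit ordinal `α`, `S_α` consists of the `E` that lie in `S_{lam α k}` for some
  `k ≤ min E` (with `min ∅ = ∞`). -/
def schreier (lam : Ordinal.{0} → ℕ+ → Ordinal.{0}) (α : Ordinal.{0}) : Set (Finset ℕ+) :=
  Ordinal.limitRecOn (motive := fun _ => Set (Finset ℕ+)) α
    {E | E = ∅ ∨ ∃ n : ℕ+, E = {n}}
    (fun _ S => {E | ∃ (n : ℕ) (P : Fin n → Finset ℕ+), IsSuccessiveUnion P E ∧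
      (∀ j, P j ∈ S) ∧ ∀ e ∈ E, n ≤ (e : ℕ)})
    (fun α _ S => {E | ∃ k : ℕ+, (∀ e ∈ E, k ≤ e) ∧ ∃ h : lam α k < α, E ∈ S (lam α k) h})

theorem schreier_zero (lam : Ordinal.{0} → ℕ+ → Ordinal.{0}) :
    schreier lam 0 = {E | E = ∅ ∨ ∃ n : ℕ+, E = {n}} := by
  simp only [schreier, Ordinal.limitRecOn_zero]

theorem schreier_add_one (lam : Ordinal.{0} → ℕ+ → Ordinal.{0}) (γ : Ordinal.{0}) :
    schreier lam (γ + 1) = {E | ∃ (n : ℕ) (P : Fin n → Finset ℕ+), IsSuccessiveUnion P E ∧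
      (∀ j, P j ∈ schreier lam γ) ∧ ∀ e ∈ E, n ≤ (e : ℕ)} := by
  simp only [schreier, Ordinal.limitRecOn_add_one]

theorem schreier_limit (lam : Ordinal.{0} → ℕ+ → Ordinal.{0}) (α : Ordinal.{0})
    (hα : Order.IsSuccLimit α) :
    schreier lam α = {E | ∃ k : ℕ+, (∀ e ∈ E, k ≤ e) ∧ lam α k < α ∧
      E ∈ schreier lam (lam α k)} := by
  simp only [schreier, Ordinal.limitRecOn_limit _ _ _ _ hα, exists_prop]

/-- The requirements on the approximating sequences `(lam α n)ₙ` of the countable limit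
ordinals `α`. Every limit ordinal has the form `γ + ω ^ ξ` with `ξ ≠ 0` and `ω ^ ξ ∣ γ`, that is,
all exponents in the Cantor normal form of `γ` are at least `ξ`. -/
structure IsAdmissible (lam : Ordinal.{0} → ℕ+ → Ordinal.{0}) : Prop where
  one_le : ∀ α < ω_ 1, Order.IsSuccLimit α → ∀ n, 1 ≤ lam α n
  lt : ∀ α < ω_ 1, Order.IsSuccLimit α → ∀ n, lam α n < α
  mono : ∀ α < ω_ 1, Order.IsSuccLimit α → Monotone (lam α)
  isLUB : ∀ α < ω_ 1, Order.IsSuccLimit α → IsLUB (Set.range (lam α)) α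
  add : ∀ γ ξ : Ordinal.{0}, ξ ≠ 0 → γ ≠ 0 → ω ^ ξ ∣ γ → γ + ω ^ ξ < ω_ 1 →
    ∀ n, lam (γ + ω ^ ξ) n = γ + lam (ω ^ ξ) n
  nested : ∀ ξ : Ordinal.{0}, ξ ≠ 0 → ω ^ ξ < ω_ 1 →
    ∀ n, schreier lam (lam (ω ^ ξ) n) ⊆ schreier lam (lam (ω ^ ξ) (n + 1))

/-! Repeated averages. -/

/-- For `A ∈ MAX(S_α)`: `z : ℕ → ℝ` is the repeated average `z_{(α,A)}`.
* `z_{(0,{n})} = e_n`;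
* if `A = A₁ ∪ … ∪ Aₙ` with `n = min A` and `A₁ < … < Aₙ` in `MAX(S_γ)`, then
  `z_{(γ+1,A)} = (z_{(γ,A₁)} + … + z_{(γ,Aₙ)}) / n`;
* for a limit ordinal `α`, `z_{(α,A)} = z_{(lam α (min A), A)}`. -/
def IsRepeatedAverage (lam : Ordinal.{0} → ℕ+ → Ordinal.{0}) (α : Ordinal.{0}) :
    Finset ℕ+ → (ℕ+ → ℝ) → Prop :=
  Ordinal.limitRecOn (motive := fun _ => Finset ℕ+ → (ℕ+ → ℝ) → Prop) α
    (fun A z => ∃ n : ℕ+, A = {n} ∧ z = Pi.single n 1)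
    (fun γ R A z => ∃ (n : ℕ) (P : Fin n → Finset ℕ+) (w : Fin n → ℕ+ → ℝ),
      IsSuccessiveUnion P A ∧ (∀ j, P j ∈ maximalSets (schreier lam γ)) ∧
      (∃ hA : A.Nonempty, n = (A.min' hA : ℕ)) ∧ (∀ j, R (P j) (w j)) ∧
      z = fun a => (1 / (n : ℝ)) * ∑ j, w j a)
    (fun α _ R A z => ∃ (hA : A.Nonempty) (h : lam α (A.min' hA) < α),
      R (lam α (A.min' hA)) h A z)

theorem isRepeatedAverage_zero (lam : Ordinal.{0} → ℕ+ → Ordinal.{0})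
    (A : Finset ℕ+) (z : ℕ+ → ℝ) :
    IsRepeatedAverage lam 0 A z ↔ ∃ n : ℕ+, A = {n} ∧ z = Pi.single n 1 := by
  simp only [IsRepeatedAverage, Ordinal.limitRecOn_zero]

theorem isRepeatedAverage_add_one (lam : Ordinal.{0} → ℕ+ → Ordinal.{0}) (γ : Ordinal.{0})
    (A : Finset ℕ+) (z : ℕ+ → ℝ) :
    IsRepeatedAverage lam (γ + 1) A z ↔
      ∃ (n : ℕ) (P : Fin n → Finset ℕ+) (w : Fin n → ℕ+ → ℝ),
        IsSuccessiveUnion P A ∧ (∀ j, P j ∈ maximalSets (schreier lam γ)) ∧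
        (∃ hA : A.Nonempty, n = (A.min' hA : ℕ)) ∧
        (∀ j, IsRepeatedAverage lam γ (P j) (w j)) ∧
        z = fun a => (1 / (n : ℝ)) * ∑ j, w j a := by
  simp only [IsRepeatedAverage, Ordinal.limitRecOn_add_one]

theorem isRepeatedAverage_limit (lam : Ordinal.{0} → ℕ+ → Ordinal.{0}) (α : Ordinal.{0})
    (hα : Order.IsSuccLimit α) (A : Finset ℕ+) (z : ℕ+ → ℝ) :
    IsRepeatedAverage lam α A z ↔ ∃ hA : A.Nonempty, lam α (A.min' hA) < α ∧
      IsRepeatedAverage lam (lam α (A.min' hA)) A z := by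
  simp only [IsRepeatedAverage, Ordinal.limitRecOn_limit _ _ _ _ hα, exists_prop]

/-- `c = z_{(α,B)}(max A)` for some extension `B ∈ MAX(S_α)` of the nonempty set `A`. -/
def IsZetaValue (lam : Ordinal.{0} → ℕ+ → Ordinal.{0}) (α : Ordinal.{0})
    (A : Finset ℕ+) (c : ℝ) : Prop :=
  ∃ (B : Finset ℕ+) (z : ℕ+ → ℝ) (hA : A.Nonempty), B ∈ maximalSets (schreier lam α) ∧
    IsInitialSegment A B ∧ IsRepeatedAverage lam α B z ∧ c = z (A.max' hA)

open scoped Classical in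
/-- `ζ(α, A) = z_{(α,B)}(max A)`, where `B` is any extension of `A` in `MAX(S_α)`
(the value does not depend on `B`); `ζ(α, ∅) = 0`. -/
def schreierZeta (lam : Ordinal.{0} → ℕ+ → Ordinal.{0}) (α : Ordinal.{0})
    (A : Finset ℕ+) : ℝ :=
  if h : ∃ c, IsZetaValue lam α A c then h.choose else 0

/-! The Szlenk index. -/

section Szlenk

variable {𝕜 X : Type*} [RCLike 𝕜] [NormedAddCommGroup X] [NormedSpace 𝕜 X]

/-- `K'_ε`: the weak-star limits `f` of sequences `(u n)` in `K` with `‖u n - f‖ > ε`. -/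
def szlenkStep (K : Set (StrongDual 𝕜 X)) (ε : ℝ) : Set (StrongDual 𝕜 X) :=
  {f | ∃ u : ℕ → StrongDual 𝕜 X, (∀ n, u n ∈ K) ∧
    (∀ x : X, Tendsto (fun n => u n x) atTop (𝓝 (f x))) ∧ ∀ n, ε < ‖u n - f‖}

/-- `K^{(β)}_ε`. -/
def szlenkDerived (K : Set (StrongDual 𝕜 X)) (ε : ℝ) (β : Ordinal.{0}) :
    Set (StrongDual 𝕜 X) :=
  Ordinal.limitRecOn (motive := fun _ => Set (StrongDual 𝕜 X)) β K
    (fun _ D => szlenkStep D ε)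
    (fun β _ D => ⋂ (γ : Ordinal.{0}) (h : γ < β), D γ h)

theorem szlenkDerived_zero (K : Set (StrongDual 𝕜 X)) (ε : ℝ) :
    szlenkDerived K ε 0 = K := by
  simp only [szlenkDerived, Ordinal.limitRecOn_zero]

theorem szlenkDerived_add_one (K : Set (StrongDual 𝕜 X)) (ε : ℝ) (β : Ordinal.{0}) :
    szlenkDerived K ε (β + 1) = szlenkStep (szlenkDerived K ε β) ε := by
  simp only [szlenkDerived, Ordinal.limitRecOn_add_one]

theorem szlenkDerived_limit (K : Set (StrongDual 𝕜 X)) (ε : ℝ) (β : Ordinal.{0})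
    (hβ : Order.IsSuccLimit β) :
    szlenkDerived K ε β = ⋂ (γ : Ordinal.{0}) (_ : γ < β), szlenkDerived K ε γ := by
  simp only [szlenkDerived, Ordinal.limitRecOn_limit _ _ _ _ hβ]

/-- `η(K, ε) = sup {β < ω₁ : K^{(β)}_ε ≠ ∅}`. -/
def szlenkEta (K : Set (StrongDual 𝕜 X)) (ε : ℝ) : Ordinal.{0} :=
  sSup {β | β < ω_ 1 ∧ (szlenkDerived K ε β).Nonempty}

variable (𝕜 X) in
/-- `Sz(X) = sup_{ε > 0} η(B_{X*}, ε)`. All suprema are of sets of ordinals bounded by `ω₁`. -/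
def szlenkIndex : Ordinal.{0} :=
  sSup {β | ∃ ε : ℝ, 0 < ε ∧ β = szlenkEta (Metric.closedBall (0 : StrongDual 𝕜 X) 1) ε}

end Szlenk

/-! Finite-dimensional decompositions. -/

/-- A finite-dimensional decomposition: finite-dimensional subspaces `F₁, F₂, …` such that every
`x` is, in a unique way, the sum of a norm convergent series `∑ x_j` with `x_j ∈ F_j`. -/
structure FDD (𝕜 X : Type*) [RCLike 𝕜] [NormedAddCommGroup X] [NormedSpace 𝕜 X] where
  space : ℕ+ → Submodule 𝕜 X
  finiteDimensional : ∀ j, FiniteDimensional 𝕜 (space j)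
  existsUnique : ∀ x : X, ∃! f : ℕ+ → X, (∀ j, f j ∈ space j) ∧
    Tendsto (fun n : ℕ+ => ∑ j ∈ Finset.Icc 1 n, f j) atTop (𝓝 x)

namespace FDD

variable {𝕜 X : Type*} [RCLike 𝕜] [NormedAddCommGroup X] [NormedSpace 𝕜 X] (F : FDD 𝕜 X)

/-- The components `x_j ∈ F_j` of `x`. -/
def coord (x : X) : ℕ+ → X := (F.existsUnique x).choose

theorem coord_spec (x : X) : (∀ j, F.coord x j ∈ F.space j) ∧
    Tendsto (fun n : ℕ+ => ∑ j ∈ Finset.Icc 1 n, F.coord x j) atTop (𝓝 x) :=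
  (F.existsUnique x).choose_spec.1

/-- `supp(x)`. -/
def supp (x : X) : Set ℕ+ := {j | F.coord x j ≠ 0}

/-- `ran(x)`: the smallest interval containing `supp(x)`. -/
def ran (x : X) : Set ℕ+ := {n | ∃ i ∈ F.supp x, ∃ k ∈ F.supp x, i ≤ n ∧ n ≤ k}

/-- An infinite block sequence: nonzero vectors with `supp(x₁) < supp(x₂) < …`. -/
def IsBlock (x : ℕ → X) : Prop :=
  ∀ n, x n ≠ 0 ∧ ∀ i ∈ F.supp (x n), ∀ j ∈ F.supp (x (n + 1)), i < j

/-- Shrinking: every bounded infinite block sequence is weakly null. -/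
def IsShrinking : Prop :=
  ∀ x : ℕ → X, F.IsBlock x → (∃ C : ℝ, ∀ n, ‖x n‖ ≤ C) →
    ∀ f : StrongDual 𝕜 X, Tendsto (fun n => f (x n)) atTop (𝓝 0)

end FDD

/-- For `B = {b₁ < … < b_d}` and `b = b_j`, the set of `n ∈ ℕ` with `b_{j-1} < n < b_{j+1}`,
where `b₀ = 0` and `b_{d+1} = ∞`. -/
def neighbourInterval (B : Finset ℕ+) (b : ℕ+) : Set ℕ+ :=
  {n | (∀ c ∈ B, c < b → c < n) ∧ ∀ c ∈ B, b < c → n < c}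

end

/-! Fix finite `ε/4`-nets `t p q` of the unit vectors ball with range in `(p, q)`, and call a finite
set `A` normed if one functional of the dual ball has modulus at least `ε/4` somewhere on `t p q`
whenever `p < a < q` in `A`. Given `B` and the `x_b`, let `g` be a norming functional of the
weighted sum. The terms with `‖g (x_b)‖ < ε/2` contribute at most `ε/2`, because the weights have
sum at most one. The other indices form a normed set: if `p < a < q` are among them, `x_a` has its
range in `(p, q)` and is close to a net vector. It remains to make the weight of every normed set
smaller than `ε/2`.

This takes two facts about the rank of a hereditary family, measured by its Cantor–Bendixson type
derivatives. Analytic fact (`exists_mem_weakDerived`): if `∅` survives `3 * β` derivations of the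
normed sets, the dual ball has a nonempty weak-star derivative of order `β`. Three new elements far
out yield a net vector far out on which some functional is large; as the FDD is shrinking, a cluster
point of such functionals is small there, so it is far from them in norm. Since `3 * ω ^ α = ω ^ α`
for `α ≠ 0`, a nonempty derivative of order `ω ^ α` would result, and averaging functionals gives
one more, against `Sz(X) ≤ ω ^ α`. Combinatorial fact (`exists_infinite_sum_lt`): if `∅` does not
survive `ω ^ α` derivations, then on some infinite `N` members of the family have small weight under
all repeated averages of order `α`. The proof is by induction on `α`. At `γ + 1` the rank is below
`ω ^ γ * k` for some finite `k`, so few of the `min C` averaged blocks can be heavy. At a limit the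
rank is below some `ω ^ β` with `β < α`, and an average with large minimum is an average of
successor order above `β`. A maximal set `C` carrying an average may leave `N`, so the statement
concerns initial segments `D` of `C` inside `N`.

If `α = 0`, an infinite-dimensional space has index greater than `1`, so the case is void. -/

noncomputable section

/-! ### Derivatives of hereditary families. -/

/-- A family of finite sets closed under subsets. -/
def IsHereditary (F : Set (Finset ℕ+)) : Prop := ∀ A ∈ F, ∀ B, B ⊆ A → B ∈ F

/-- The transfinite Cantor–Bendixson type derivatives of a family of finite sets, along the
infinite set `M`. -/
def derivedFamily (F : Set (Finset ℕ+)) (M : Set ℕ+) (β : Ordinal.{0}) : Set (Finset ℕ+) :=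
  {A | A ∈ F ∧ ∀ γ, γ < β → {n | n ∈ M ∧ insert n A ∈ derivedFamily F M γ}.Infinite}
termination_by β

theorem mem_derivedFamily {F : Set (Finset ℕ+)} {M : Set ℕ+} {β : Ordinal.{0}} {A : Finset ℕ+} :
    A ∈ derivedFamily F M β ↔
      A ∈ F ∧ ∀ γ < β, {n | n ∈ M ∧ insert n A ∈ derivedFamily F M γ}.Infinite := by
  rw [derivedFamily]; rfl

theorem derivedFamily_zero (F : Set (Finset ℕ+)) (M : Set ℕ+) : derivedFamily F M 0 = F := by
  ext A
  rw [mem_derivedFamily]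
  exact ⟨fun h => h.1, fun h => ⟨h, fun γ hγ => absurd hγ (not_lt_bot (a := γ))⟩⟩

theorem derivedFamily_anti (F : Set (Finset ℕ+)) (M : Set ℕ+) {β γ : Ordinal.{0}} (h : β ≤ γ) :
    derivedFamily F M γ ⊆ derivedFamily F M β := by
  intro A hA
  rw [mem_derivedFamily] at hA ⊢
  exact ⟨hA.1, fun δ hδ => hA.2 δ (hδ.trans_le h)⟩

theorem derivedFamily_mono_set (F : Set (Finset ℕ+)) {N M : Set ℕ+} (h : N ⊆ M)
    (β : Ordinal.{0}) : derivedFamily F N β ⊆ derivedFamily F M β := by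
  induction β using WellFoundedLT.induction with
  | ind β ih =>
    intro A hA
    rw [mem_derivedFamily] at hA ⊢
    exact ⟨hA.1, fun γ hγ => (hA.2 γ hγ).mono fun n hn => ⟨h hn.1, ih γ hγ hn.2⟩⟩

theorem IsHereditary.derivedFamily {F : Set (Finset ℕ+)} (hF : IsHereditary F) (M : Set ℕ+)
    (β : Ordinal.{0}) : IsHereditary (derivedFamily F M β) := by
  induction β using WellFoundedLT.induction with
  | ind β ih =>
    intro A hA B hB
    rw [mem_derivedFamily] at hA ⊢
    exact ⟨hF A hA.1 B hB, fun γ hγ => (hA.2 γ hγ).mono fun n hn =>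
      ⟨hn.1, ih γ hγ _ hn.2 _ (Finset.insert_subset_insert n hB)⟩⟩

theorem derivedFamily_derivedFamily_subset (F : Set (Finset ℕ+)) (M : Set ℕ+)
    (β γ : Ordinal.{0}) :
    derivedFamily (derivedFamily F M β) M γ ⊆ derivedFamily F M (β + γ) := by
  induction γ using WellFoundedLT.induction with
  | ind γ ih =>
    intro A hA
    rw [mem_derivedFamily] at hA
    have h1 := mem_derivedFamily.1 hA.1
    refine mem_derivedFamily.2 ⟨h1.1, fun δ hδ => ?_⟩
    rcases lt_or_ge δ β with h | h
    · exact h1.2 δ h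
    · obtain ⟨γ', rfl⟩ := exists_add_of_le h
      have hγ' : γ' < γ := by simpa using hδ
      exact (hA.2 γ' hγ').mono fun n hn => ⟨hn.1, ih γ' hγ' hn.2⟩

/-- The sets which extend `A` within `F`. -/
def sliceFamily (F : Set (Finset ℕ+)) (A : Finset ℕ+) : Set (Finset ℕ+) := {C | A ∪ C ∈ F}

theorem IsHereditary.sliceFamily {F : Set (Finset ℕ+)} (hF : IsHereditary F) (A : Finset ℕ+) :
    IsHereditary (sliceFamily F A) :=
  fun _ hC _ hB => hF _ hC _ (Finset.union_subset_union_right hB)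

/-- Used contrapositively with `C = ∅`: if `A` has been removed from `F` by stage `β`, the sets
extending `A` again form a family of rank at most `β`. -/
theorem union_mem_of_mem_derivedFamily_slice (F : Set (Finset ℕ+)) (M : Set ℕ+) (A : Finset ℕ+)
    (β : Ordinal.{0}) (C : Finset ℕ+) (hC : C ∈ derivedFamily (sliceFamily F A) M β) :
    A ∪ C ∈ derivedFamily F M β := by
  induction β using WellFoundedLT.induction generalizing C with
  | ind β ih =>
    rw [mem_derivedFamily] at hC ⊢
    refine ⟨hC.1, fun γ hγ => (hC.2 γ hγ).mono fun n hn => ⟨hn.1, ?_⟩⟩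
    have := ih γ hγ _ hn.2
    rwa [Finset.union_insert] at this

/-! ### Diagonalization, and families of rank `β * k`. -/

theorem Set.Infinite.inter_Ioi {X : Set ℕ+} (hX : X.Infinite) (m : ℕ+) :
    (X ∩ Set.Ioi m).Infinite := by
  have : X \ Set.Iic m = X ∩ Set.Ioi m := by ext; simp
  rw [← this]
  exact hX.sdiff (Set.finite_Iic m)

/-- Diagonalization: a property of infinite sets that is hereditary and dense below `M`, for each
`n`, holds on a single set for all tails. -/
theorem exists_diagonal (M : Set ℕ+) (hM : M.Infinite) (R : ℕ+ → Set ℕ+ → Prop)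
    (hmono : ∀ n N N', N' ⊆ N → R n N → R n N')
    (hdense : ∀ n, ∀ N ⊆ M, N.Infinite → ∃ N' ⊆ N, N'.Infinite ∧ R n N') :
    ∃ N ⊆ M, N.Infinite ∧ ∀ n ∈ N, R n (N ∩ Set.Ioi n) := by
  have step : ∀ s : {p : ℕ+ × Set ℕ+ // p.2 ⊆ M ∧ p.2.Infinite}, ∃ t :
      {p : ℕ+ × Set ℕ+ // p.2 ⊆ M ∧ p.2.Infinite},
      t.1.1 ∈ s.1.2 ∧ t.1.2 ⊆ s.1.2 ∧ R t.1.1 t.1.2 ∧ t.1.2 ⊆ Set.Ioi t.1.1 := by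
    rintro ⟨⟨n, N⟩, hN, hinf⟩
    obtain ⟨m, hm⟩ := hinf.nonempty
    obtain ⟨N', h1, h2, h3⟩ := hdense m _ (Set.inter_subset_left.trans hN) (hinf.inter_Ioi m)
    exact ⟨⟨⟨m, N'⟩, (h1.trans Set.inter_subset_left).trans hN, h2⟩, hm,
      h1.trans Set.inter_subset_left, h3, h1.trans Set.inter_subset_right⟩
  choose g hg using step
  let s : ℕ → {p : ℕ+ × Set ℕ+ // p.2 ⊆ M ∧ p.2.Infinite} :=
    fun k => Nat.rec ⟨⟨1, M⟩, subset_rfl, hM⟩ (fun _ t => g t) k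
  have hs : ∀ k, s (k + 1) = g (s k) := fun k => rfl
  have hanti : Antitone fun k => (s k).1.2 := antitone_nat_of_succ_le fun k => by
    change (s (k + 1)).1.2 ⊆ _
    rw [hs]; exact (hg (s k)).2.1
  have hmem : ∀ k l, k ≤ l → (s (l + 1)).1.1 ∈ (s k).1.2 := fun k l hkl => by
    rw [hs]; exact hanti hkl (hg (s l)).1
  have hlt : ∀ k l, k < l → (s (k + 1)).1.1 < (s (l + 1)).1.1 := fun k l hkl => by
    have h1 := hmem (k + 1) l hkl
    have h2 := (hg (s k)).2.2.2
    rw [← hs] at h2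
    exact h2 h1
  have hstrict : StrictMono fun k => (s (k + 1)).1.1 := fun k l hkl => hlt k l hkl
  refine ⟨Set.range fun k => (s (k + 1)).1.1, ?_, Set.infinite_range_of_injective
    hstrict.injective, ?_⟩
  · rintro _ ⟨k, rfl⟩
    exact (s k).2.1 (hmem k k le_rfl)
  · rintro _ ⟨k, rfl⟩
    have h3 := (hg (s k)).2.2.1
    rw [← hs] at h3
    refine hmono _ _ _ ?_ h3
    rintro _ ⟨⟨l, rfl⟩, hl⟩
    exact hmem (k + 1) l (hstrict.lt_iff_lt.1 hl)

/-- Finitely many hereditary dense properties hold on a common infinite set. -/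
theorem exists_infinite_forall_finset {ι : Type*} (M : Set ℕ+) (R : ι → Set ℕ+ → Prop)
    (hmono : ∀ i N N', N' ⊆ N → R i N → R i N')
    (hdense : ∀ i, ∀ N ⊆ M, N.Infinite → ∃ N' ⊆ N, N'.Infinite ∧ R i N') (s : Finset ι) :
    ∀ N ⊆ M, N.Infinite → ∃ N' ⊆ N, N'.Infinite ∧ ∀ i ∈ s, R i N' := by
  classical
  induction s using Finset.induction_on with
  | empty => exact fun N _ hi => ⟨N, subset_rfl, hi, by simp⟩
  | insert a s _ ih =>
    intro N hN hi
    obtain ⟨N1, h1, h2, h3⟩ := ih N hN hi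
    obtain ⟨N2, h4, h5, h6⟩ := hdense a N1 (h1.trans hN) h2
    refine ⟨N2, h4.trans h1, h5, fun i hi => ?_⟩
    rcases Finset.mem_insert.1 hi with rfl | hi
    · exact h6
    · exact hmono _ _ _ h4 (h3 i hi)

/-- The union of the first components. -/
def unionFst (l : List (Finset ℕ+ × Finset ℕ+)) : Finset ℕ+ :=
  l.foldr (fun p E => p.1 ∪ E) ∅

theorem unionFst_cons (p : Finset ℕ+ × Finset ℕ+) (l : List (Finset ℕ+ × Finset ℕ+)) :
    unionFst (p :: l) = p.1 ∪ unionFst l := rfl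

theorem unionFst_subset {l : List (Finset ℕ+ × Finset ℕ+)} {A : Finset ℕ+}
    (h : ∀ p ∈ l, p.1 ⊆ A) : unionFst l ⊆ A := by
  induction l with
  | nil => simp [unionFst]
  | cons p l ih =>
    rw [unionFst_cons]
    exact Finset.union_subset (h p (by simp)) (ih fun q hq => h q (by simp [hq]))

/-- If every family of rank at most `β` avoids the pairs in `L` on a smaller infinite set, then
every family of rank at most `β * k` avoids the unions of `k` successive pairs. -/
theorem exists_infinite_avoiding_unions (L : Set (Finset ℕ+ × Finset ℕ+))
    (hL : ∀ p ∈ L, p.1 ⊆ p.2) (hLne : ∀ p ∈ L, p.1.Nonempty) (β : Ordinal.{0})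
    (hQ : ∀ (F : Set (Finset ℕ+)) (M : Set ℕ+), IsHereditary F → M.Infinite →
      ∅ ∉ derivedFamily F M β → ∃ N ⊆ M, N.Infinite ∧
        ∀ p ∈ L, (p.2 : Set ℕ+) ⊆ N → p.1 ∉ F) (k : ℕ) :
    ∀ (F : Set (Finset ℕ+)) (M : Set ℕ+), IsHereditary F → M.Infinite →
      ∅ ∉ derivedFamily F M (β * k) → ∃ N ⊆ M, N.Infinite ∧
        ∀ l : List (Finset ℕ+ × Finset ℕ+), k ≤ l.length → (∀ p ∈ l, p ∈ L) →
          (∀ p ∈ l, (p.2 : Set ℕ+) ⊆ N) → l.Pairwise (fun p q => SetLT p.2 q.2) →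
            unionFst l ∉ F := by
  induction k with
  | zero =>
    intro F M hF hM h0
    refine ⟨M, subset_rfl, hM, fun l _ _ _ _ hl => h0 ?_⟩
    simpa [derivedFamily_zero] using hF _ hl ∅ (Finset.empty_subset _)
  | succ k ih =>
    intro F M hF hM h0
    -- As `β * (k + 1) = β * k + β`, the derivative `G` has rank at most `β`. So the first piece of
    -- a long union can be kept outside `G`, and then its slice has rank at most `β * k`.
    set G := derivedFamily F M (β * k) with hG
    have hG0 : ∅ ∉ derivedFamily G M β := fun h => h0 <| by
      have := derivedFamily_derivedFamily_subset F M (β * k) β h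
      rwa [← mul_add_one, ← Nat.cast_add_one] at this
    obtain ⟨N₀, hN₀M, hN₀, hN₀L⟩ := hQ G M (hF.derivedFamily M _) hM hG0
    let T : Finset ℕ+ → Set ℕ+ → Prop := fun A N => A ∉ G →
      ∀ l : List (Finset ℕ+ × Finset ℕ+), k ≤ l.length → (∀ p ∈ l, p ∈ L) →
        (∀ p ∈ l, (p.2 : Set ℕ+) ⊆ N) → l.Pairwise (fun p q => SetLT p.2 q.2) →
          A ∪ unionFst l ∉ F
    have hTmono : ∀ A N N', N' ⊆ N → T A N → T A N' := fun A N N' h hT hA l h1 h2 h3 h4 =>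
      hT hA l h1 h2 (fun p hp => (h3 p hp).trans h) h4
    have hTdense : ∀ A, ∀ N ⊆ N₀, N.Infinite → ∃ N' ⊆ N, N'.Infinite ∧ T A N' := by
      intro A N hN hi
      by_cases hA : A ∈ G
      · exact ⟨N, subset_rfl, hi, fun h => absurd hA h⟩
      · have h1 : ∅ ∉ derivedFamily (sliceFamily F A) N (β * k) := fun h => hA <| by
          have := union_mem_of_mem_derivedFamily_slice F N A _ ∅ h
          rw [Finset.union_empty] at this
          exact derivedFamily_mono_set F (hN.trans hN₀M) _ this
        obtain ⟨N', h2, h3, h4⟩ := ih (sliceFamily F A) N (hF.sliceFamily A) hi h1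
        exact ⟨N', h2, h3, fun _ => h4⟩
    -- The set given by induction depends on the first piece `A`. Only finitely many `A` have
    -- maximum `n`, so all of them can be treated when `n` is chosen.
    obtain ⟨N, hN, hNi, hNR⟩ := exists_diagonal N₀ hN₀
      (fun n N => ∀ A ∈ (Finset.Icc 1 n).powerset, T A N)
      (fun n N N' h hR A hA => hTmono A N N' h (hR A hA))
      (fun n => exists_infinite_forall_finset N₀ T hTmono hTdense _)
    refine ⟨N, hN.trans hN₀M, hNi, fun l hl hlL hlN hlp => ?_⟩
    cases l with
    | nil => simp at hl
    | cons p l =>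
      rw [unionFst_cons]
      have hpL := hlL p (by simp)
      have hpN := hlN p (by simp)
      have hne := hLne p hpL
      have hmax : p.1.max' hne ∈ p.2 := hL p hpL (Finset.max'_mem _ _)
      refine hNR (p.1.max' hne) (hpN hmax) p.1 ?_ (hN₀L p hpL (hpN.trans hN)) l
        (by simpa using hl) (fun q hq => hlL q (by simp [hq])) (fun q hq x hx => ?_)
        (List.pairwise_cons.1 hlp).2
      · rw [Finset.mem_powerset]
        exact fun a ha => Finset.mem_Icc.2 ⟨one_le, Finset.le_max' _ _ ha⟩
      · exact ⟨hlN q (by simp [hq]) hx, (List.pairwise_cons.1 hlp).1 q hq _ hmax x hx⟩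

/-! ### Unions of successive sets and basic properties of the Schreier families. -/

/-- Unions `A₁ ∪ … ∪ Aₙ` with `A₁ < … < Aₙ` in `S`. -/
def succUnion (S : Set (Finset ℕ+)) : ℕ → Set (Finset ℕ+)
  | 0 => {∅}
  | n + 1 => {E | ∃ A ∈ S, ∃ B ∈ succUnion S n, SetLT A B ∧ E = A ∪ B}

section succUnion

variable {S : Set (Finset ℕ+)}

theorem succUnion_subset_succ (h0 : ∅ ∈ S) (n : ℕ) : succUnion S n ⊆ succUnion S (n + 1) :=
  fun E hE => ⟨∅, h0, E, hE, by simp [SetLT], by simp⟩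

theorem succUnion_mono (h0 : ∅ ∈ S) : Monotone (succUnion S) :=
  monotone_nat_of_le_succ (succUnion_subset_succ h0)

theorem IsHereditary.succUnion (hS : IsHereditary S) (n : ℕ) :
    IsHereditary (succUnion S n) := by
  induction n with
  | zero =>
    rintro A rfl B hB
    exact Finset.subset_empty.1 hB
  | succ n ih =>
    rintro _ ⟨A, hA, B, hB, hAB, rfl⟩ C hC
    refine ⟨C ∩ A, hS A hA _ Finset.inter_subset_right, C ∩ B, ih B hB _ Finset.inter_subset_right,
      fun a ha b hb => hAB a (Finset.mem_inter.1 ha).2 b (Finset.mem_inter.1 hb).2, ?_⟩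
    rw [← Finset.inter_union_distrib_left, Finset.inter_eq_left.2 hC]

theorem mem_succUnion_of_isSuccessiveUnion {n : ℕ} (P : Fin n → Finset ℕ+) {E : Finset ℕ+}
    (hP : IsSuccessiveUnion P E) (hS : ∀ j, P j ∈ S) : E ∈ succUnion S n := by
  induction n generalizing E with
  | zero => simpa [succUnion] using hP.2.2
  | succ n ih =>
    obtain ⟨h1, h2, rfl⟩ := hP
    refine ⟨P 0, hS 0, _, ih (fun j => P j.succ) ⟨fun j => h1 _, fun i j hij =>
      h2 _ _ (Fin.succ_lt_succ_iff.2 hij), rfl⟩ fun j => hS _, ?_, ?_⟩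
    · intro a ha b hb
      simp only [Finset.mem_biUnion, Finset.mem_univ, true_and] at hb
      obtain ⟨j, hj⟩ := hb
      exact h2 0 j.succ (Fin.succ_pos j) a ha b hj
    · ext x
      simp [Fin.exists_fin_succ]

theorem exists_isSuccessiveUnion_of_mem_succUnion {n : ℕ} {E : Finset ℕ+}
    (hE : E ∈ succUnion S n) :
    ∃ m ≤ n, ∃ P : Fin m → Finset ℕ+, IsSuccessiveUnion P E ∧ ∀ j, P j ∈ S := by
  induction n generalizing E with
  | zero =>
    obtain rfl : E = ∅ := hE
    exact ⟨0, le_rfl, Fin.elim0, ⟨fun j => j.elim0, fun j => j.elim0, by simp⟩, fun j => j.elim0⟩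
  | succ n ih =>
    obtain ⟨A, hA, B, hB, hAB, rfl⟩ := hE
    obtain ⟨m, hm, P, ⟨h1, h2, rfl⟩, h4⟩ := ih hB
    rcases A.eq_empty_or_nonempty with rfl | hne
    · exact ⟨m, hm.trans n.le_succ, P, ⟨h1, h2, by simp⟩, h4⟩
    · refine ⟨m + 1, by omega, Fin.cons A P, ⟨?_, ?_, ?_⟩, ?_⟩
      · intro j
        refine Fin.cases ?_ (fun j => ?_) j
        · simpa using hne
        · simpa using h1 j
      · intro i j hij
        induction j using Fin.cases with
        | zero => exact absurd hij (Fin.not_lt_zero i)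
        | succ j =>
          induction i using Fin.cases with
          | zero =>
            simp only [Fin.cons_zero, Fin.cons_succ]
            exact fun a ha b hb => hAB a ha b (Finset.mem_biUnion.2 ⟨j, Finset.mem_univ _, hb⟩)
          | succ i =>
            simp only [Fin.cons_succ]
            exact h2 i j (Fin.succ_lt_succ_iff.1 hij)
      · ext x
        simp [Fin.exists_fin_succ]
      · intro j
        refine Fin.cases ?_ (fun j => ?_) j
        · simpa using hA
        · simpa using h4 j

end succUnion

/-- `succUnion` admits empty pieces, which makes it increasing in the number of pieces; discarding
them only lowers `n`, so the bound by the minimum persists. -/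
theorem mem_schreier_add_one {lam : Ordinal.{0} → ℕ+ → Ordinal.{0}} {γ : Ordinal.{0}}
    {E : Finset ℕ+} : E ∈ schreier lam (γ + 1) ↔
      ∃ n : ℕ, E ∈ succUnion (schreier lam γ) n ∧ ∀ e ∈ E, n ≤ (e : ℕ) := by
  rw [schreier_add_one]
  constructor
  · rintro ⟨n, P, hP, hS, hE⟩
    exact ⟨n, mem_succUnion_of_isSuccessiveUnion P hP hS, hE⟩
  · rintro ⟨n, hn, hE⟩
    obtain ⟨m, hm, P, hP, hS⟩ := exists_isSuccessiveUnion_of_mem_succUnion hn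
    exact ⟨m, P, hP, hS, fun e he => hm.trans (hE e he)⟩

theorem isHereditary_schreier (lam : Ordinal.{0} → ℕ+ → Ordinal.{0}) (α : Ordinal.{0}) :
    IsHereditary (schreier lam α) := by
  induction α using Ordinal.limitRecOn with
  | zero =>
    rw [schreier_zero]
    rintro A (rfl | ⟨n, rfl⟩) B hB
    · exact Or.inl (Finset.subset_empty.1 hB)
    · rcases Finset.subset_singleton_iff.1 hB with h | h
      · exact Or.inl h
      · exact Or.inr ⟨n, h⟩
  | add_one γ ih =>
    intro A hA B hB
    obtain ⟨n, hn, hnA⟩ := mem_schreier_add_one.1 hA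
    exact mem_schreier_add_one.2 ⟨n, ih.succUnion n A hn B hB,
      fun e he => hnA e (hB he)⟩
  | limit α hl ih =>
    rw [schreier_limit _ _ hl]
    rintro A ⟨k, hk, hlt, hA⟩ B hB
    exact ⟨k, fun e he => hk e (hB he), hlt, ih _ hlt A hA B hB⟩

theorem IsAdmissible.exists_lt_lam {lam : Ordinal.{0} → ℕ+ → Ordinal.{0}} (h : IsAdmissible lam)
    {α β : Ordinal.{0}} (hα : α < ω_ 1) (hl : Order.IsSuccLimit α) (hβ : β < α) :
    ∃ k, β < lam α k := by
  obtain ⟨_, ⟨k, rfl⟩, hk⟩ := (lt_isLUB_iff (h.isLUB α hα hl)).1 hβ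
  exact ⟨k, hk⟩

section schreier

variable {lam : Ordinal.{0} → ℕ+ → Ordinal.{0}} (hlam : IsAdmissible lam)
include hlam

theorem empty_mem_schreier {α : Ordinal.{0}} (hα : α < ω_ 1) : ∅ ∈ schreier lam α := by
  induction α using Ordinal.limitRecOn with
  | zero => simp [schreier_zero]
  | add_one γ ih => exact mem_schreier_add_one.2 ⟨0, rfl, by simp⟩
  | limit α hl ih =>
    rw [schreier_limit _ _ hl]
    have := hlam.lt α hα hl 1
    exact ⟨1, by simp, this, ih _ this (this.trans hα)⟩

theorem singleton_mem_schreier {α : Ordinal.{0}} (hα : α < ω_ 1) (n : ℕ+) :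
    {n} ∈ schreier lam α := by
  induction α using Ordinal.limitRecOn with
  | zero => simp [schreier_zero]
  | add_one γ ih =>
    refine mem_schreier_add_one.2 ⟨1, ⟨{n}, ih ((lt_add_one γ).trans hα), ∅, rfl, ?_, by simp⟩, ?_⟩
    · simp [SetLT]
    · simp only [Finset.mem_singleton, forall_eq]
      exact Nat.succ_le_of_lt n.2
  | limit α hl ih =>
    rw [schreier_limit _ _ hl]
    have := hlam.lt α hα hl 1
    exact ⟨1, by simp, this, ih _ this (this.trans hα)⟩

/-- For `β ≤ γ` the sets of `S_β` that are far out belong to `S_γ`. -/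
theorem exists_schreier_subset {β γ : Ordinal.{0}} (hγ : γ < ω_ 1) (h : β ≤ γ) :
    ∃ n₀ : ℕ+, ∀ E ∈ schreier lam β, (∀ e ∈ E, n₀ ≤ e) → E ∈ schreier lam γ := by
  induction γ using Ordinal.limitRecOn with
  | zero =>
    obtain rfl : β = 0 := by simpa using h
    exact ⟨1, fun E hE _ => hE⟩
  | add_one γ ih =>
    rcases h.eq_or_lt with rfl | h
    · exact ⟨1, fun E hE _ => hE⟩
    obtain ⟨n₀, hn₀⟩ := ih ((lt_add_one γ).trans hγ) (Order.lt_add_one_iff.1 h)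
    exact ⟨n₀, fun E hE hE' => mem_schreier_add_one.2
      ⟨1, ⟨E, hn₀ E hE hE', ∅, rfl, by simp [SetLT], by simp⟩, fun e _ => Nat.succ_le_of_lt e.2⟩⟩
  | limit γ hl ih =>
    rcases h.eq_or_lt with rfl | h
    · exact ⟨1, fun E hE _ => hE⟩
    obtain ⟨k, hk⟩ := hlam.exists_lt_lam hγ hl h
    have hlt := hlam.lt γ hγ hl k
    obtain ⟨n₀, hn₀⟩ := ih _ hlt (hlt.trans hγ) hk.le
    refine ⟨max n₀ k, fun E hE hE' => ?_⟩
    rw [schreier_limit _ _ hl]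
    exact ⟨k, fun e he => (le_max_right _ _).trans (hE' e he), hlt,
      hn₀ E hE fun e he => (le_max_left _ _).trans (hE' e he)⟩

end schreier

/-! ### Block structure of `S_{γ+β}` and monotonicity along approximating sequences. -/

/-- Sets decomposed into successive blocks from `S`, whose minima form a member of `G`; `g` maps
an element to the minimum of its block. -/
def blockUnion (G S : Set (Finset ℕ+)) : Set (Finset ℕ+) :=
  {E | ∃ g : ℕ+ → ℕ+, (∀ e ∈ E, g e ∈ E ∧ g e ≤ e ∧ g (g e) = g e) ∧
    (∀ e ∈ E, ∀ e' ∈ E, e ≤ e' → g e ≤ g e') ∧ E.image g ∈ G ∧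
    ∀ h, E.filter (g · = h) ∈ S}

theorem blockUnion_mono {G G' : Set (Finset ℕ+)} (h : G ⊆ G') (S : Set (Finset ℕ+)) :
    blockUnion G S ⊆ blockUnion G' S :=
  fun _ ⟨g, h1, h2, h3, h4⟩ => ⟨g, h1, h2, h h3, h4⟩

/-- Successive groups of blocks correspond to successive groups of block minima: one direction glues
the two maps `g`, the other restricts `g` to the elements whose block minimum lies in a given part.
-/
theorem succUnion_blockUnion {G S : Set (Finset ℕ+)} (hS : ∅ ∈ S) (n : ℕ) :
    succUnion (blockUnion G S) n = blockUnion (succUnion G n) S := by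
  apply Set.Subset.antisymm
  · induction n with
    | zero =>
      rintro E rfl
      exact ⟨id, by simp, by simp, by simp [succUnion], by simpa using hS⟩
    | succ n ih =>
      rintro _ ⟨A, ⟨g₁, hA1, hA2, hA3, hA4⟩, B, hB, hAB, rfl⟩
      obtain ⟨g₂, hB1, hB2, hB3, hB4⟩ := ih hB
      classical
      have hdis : ∀ e ∈ B, e ∉ A := fun e he he' => lt_irrefl e (hAB e he' e he)
      let g : ℕ+ → ℕ+ := fun e => if e ∈ A then g₁ e else g₂ e
      have gA : ∀ e ∈ A, g e = g₁ e := fun e he => if_pos he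
      have gB : ∀ e ∈ B, g e = g₂ e := fun e he => if_neg (hdis e he)
      refine ⟨g, ?_, ?_, ⟨A.image g₁, hA3, B.image g₂, hB3, ?_, ?_⟩, ?_⟩
      · intro e he
        rcases Finset.mem_union.1 he with he | he
        · obtain ⟨h1, h2, h3⟩ := hA1 e he
          rw [gA e he]
          exact ⟨Finset.mem_union_left _ h1, h2, by rw [gA _ h1, h3]⟩
        · obtain ⟨h1, h2, h3⟩ := hB1 e he
          rw [gB e he]
          exact ⟨Finset.mem_union_right _ h1, h2, by rw [gB _ h1, h3]⟩
      · intro e he e' he' hle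
        rcases Finset.mem_union.1 he with he | he <;> rcases Finset.mem_union.1 he' with he' | he'
        · rw [gA e he, gA e' he']
          exact hA2 e he e' he' hle
        · rw [gA e he, gB e' he']
          exact (hAB _ (hA1 e he).1 _ (hB1 e' he').1).le
        · exact absurd (hAB e' he' e he) hle.not_gt
        · rw [gB e he, gB e' he']
          exact hB2 e he e' he' hle
      · intro a ha b hb
        obtain ⟨a, ha', rfl⟩ := Finset.mem_image.1 ha
        obtain ⟨b, hb', rfl⟩ := Finset.mem_image.1 hb
        exact hAB _ (hA1 a ha').1 _ (hB1 b hb').1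
      · rw [Finset.image_union, Finset.image_congr (f := g) (g := g₁) fun e he => gA e he,
          Finset.image_congr (f := g) (g := g₂) fun e he => gB e he]
      · intro h
        rw [Finset.filter_union]
        by_cases hh : h ∈ A
        · have h1 : B.filter (g · = h) = ∅ := Finset.filter_eq_empty_iff.2 fun e he heq => by
            rw [gB e he] at heq
            exact hdis _ (heq ▸ (hB1 e he).1) hh
          rw [h1, Finset.union_empty, Finset.filter_congr fun e he => by rw [gA e he]]
          exact hA4 h
        · have h1 : A.filter (g · = h) = ∅ := Finset.filter_eq_empty_iff.2 fun e he heq => by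
            rw [gA e he] at heq
            exact hh (heq ▸ (hA1 e he).1)
          rw [h1, Finset.empty_union, Finset.filter_congr fun e he => by rw [gB e he]]
          exact hB4 h
  · induction n with
    | zero =>
      rintro E ⟨g, -, -, h3, -⟩
      exact Finset.image_eq_empty.1 h3
    | succ n ih =>
      rintro E ⟨g, h1, h2, ⟨H₁, hH₁, H₂, hH₂, hlt, heq⟩, h4⟩
      have key : ∀ H, H ⊆ E.image g → (∀ e ∈ E.filter (g · ∈ H), g e ∈ E.filter (g · ∈ H) ∧
          g e ≤ e ∧ g (g e) = g e) ∧ (∀ e ∈ E.filter (g · ∈ H), ∀ e' ∈ E.filter (g · ∈ H),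
            e ≤ e' → g e ≤ g e') ∧ (E.filter (g · ∈ H)).image g = H ∧
            ∀ h, (E.filter (g · ∈ H)).filter (g · = h) ∈ S := by
        intro H hH
        refine ⟨fun e he => ?_, fun e he e' he' => ?_, ?_, fun h => ?_⟩
        · obtain ⟨he, heH⟩ := Finset.mem_filter.1 he
          obtain ⟨h5, h6, h7⟩ := h1 e he
          exact ⟨Finset.mem_filter.2 ⟨h5, h7.symm ▸ heH⟩, h6, h7⟩
        · exact h2 e (Finset.mem_filter.1 he).1 e' (Finset.mem_filter.1 he').1
        · ext h
          simp only [Finset.mem_image, Finset.mem_filter]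
          constructor
          · rintro ⟨e, ⟨_, h5⟩, rfl⟩
            exact h5
          · intro hh
            obtain ⟨e, he, rfl⟩ := Finset.mem_image.1 (hH hh)
            exact ⟨e, ⟨he, hh⟩, rfl⟩
        · by_cases hh : h ∈ H
          · convert h4 h using 1
            ext e
            simp only [Finset.mem_filter]
            exact ⟨fun h => ⟨h.1.1, h.2⟩, fun h => ⟨⟨h.1, h.2 ▸ hh⟩, h.2⟩⟩
          · convert hS using 1
            refine Finset.filter_eq_empty_iff.2 fun e he heq => hh ?_
            exact heq ▸ (Finset.mem_filter.1 he).2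
      obtain ⟨a1, a2, a3, a4⟩ := key H₁ (heq ▸ Finset.subset_union_left)
      obtain ⟨b1, b2, b3, b4⟩ := key H₂ (heq ▸ Finset.subset_union_right)
      refine ⟨E.filter (g · ∈ H₁), ⟨g, a1, a2, a3.symm ▸ hH₁, a4⟩, E.filter (g · ∈ H₂),
        ih ⟨g, b1, b2, b3.symm ▸ hH₂, b4⟩, fun a ha b hb => ?_, ?_⟩
      · rw [Finset.mem_filter] at ha hb
        by_contra hle
        exact absurd (hlt _ ha.2 _ hb.2) (h2 b hb.1 a ha.1 (not_lt.1 hle)).not_gt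
      · ext e
        simp only [Finset.mem_union, Finset.mem_filter, ← and_or_left]
        exact ⟨fun he => ⟨he, Finset.mem_union.1 (heq ▸ Finset.mem_image_of_mem g he)⟩,
          fun he => he.1⟩

/-- Every limit ordinal is `γ + ω ^ ξ` with `ξ ≠ 0` and `ω ^ ξ ∣ γ`. -/
theorem exists_eq_add_opow_of_isSuccLimit (α : Ordinal.{0}) (hα : Order.IsSuccLimit α) :
    ∃ γ ξ : Ordinal.{0}, ξ ≠ 0 ∧ ω ^ ξ ∣ γ ∧ α = γ + ω ^ ξ := by
  induction α using WellFoundedLT.induction with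
  | ind α ih =>
    have hα0 : α ≠ 0 := hα.ne_bot
    -- Split off the leading Cantor term. If nothing remains, one copy of `ω ^ e` is separated from
    -- it; otherwise the remainder is a smaller limit ordinal with smaller exponents.
    have hmod := div_add_mod α (ω ^ log ω α)
    set e := log ω α with he
    rcases eq_or_ne (α % ω ^ e) 0 with h0 | h0
    · obtain ⟨n, hn⟩ := lt_omega0.1 (div_opow_log_lt α one_lt_omega0)
      rw [← he] at hn
      rw [h0, add_zero, hn] at hmod
      cases n with
      | zero => simp at hmod; exact absurd hmod.symm hα0
      | succ n =>
        refine ⟨ω ^ e * n, e, fun he0 => ?_, dvd_mul_right _ _, ?_⟩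
        · rw [he0, opow_zero, one_mul] at hmod
          rw [← hmod, Nat.cast_add_one] at hα
          exact hα.isSuccPrelimit _ (Order.covBy_add_one _)
        · rw [← hmod, Nat.cast_add_one, mul_add_one]
    · have hl : Order.IsSuccLimit (α % ω ^ e) := by
        rw [← hmod, isSuccLimit_add_iff] at hα
        exact hα.resolve_right fun h => h0 h.1
      have hlt : α % ω ^ e < ω ^ e := mod_lt _ (opow_pos _ omega0_pos).ne'
      obtain ⟨γ, ξ, hξ, hdvd, heq⟩ := ih _ (mod_opow_log_lt_self ω hα0) hl
      have hle : ω ^ ξ ≤ α % ω ^ e := heq ▸ le_add_self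
      have hξe : ξ ≤ e := ((opow_lt_opow_iff_right one_lt_omega0).1 (hle.trans_lt hlt)).le
      refine ⟨ω ^ e * (α / ω ^ e) + γ, ξ, hξ,
        dvd_add ((opow_dvd_opow ω hξe).trans (dvd_mul_right _ _)) hdvd, ?_⟩
      rw [add_assoc, ← heq, hmod]

section nested

variable {lam : Ordinal.{0} → ℕ+ → Ordinal.{0}} (hlam : IsAdmissible lam)
include hlam

/-- Write `β = δ + ω ^ η` with `η ≤ ξ`; the additivity requirement applies both to `δ` and to `γ +
δ`. -/
theorem IsAdmissible.lam_add {γ ξ β : Ordinal.{0}} (hγ : γ ≠ 0) (hd : ω ^ ξ ∣ γ)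
    (hω : γ + ω ^ ξ < ω_ 1) (hβ : β < ω ^ ξ) (hl : Order.IsSuccLimit β) (n : ℕ+) :
    lam (γ + β) n = γ + lam β n := by
  obtain ⟨δ, η, hη, hδ, rfl⟩ := exists_eq_add_opow_of_isSuccLimit β hl
  have hηξ : η ≤ ξ := ((opow_lt_opow_iff_right one_lt_omega0).1
    (le_add_self.trans_lt hβ)).le
  have hd' : ω ^ η ∣ γ := (opow_dvd_opow ω hηξ).trans hd
  have hω' : γ + (δ + ω ^ η) < ω_ 1 := (add_le_add_right hβ.le γ).trans_lt hω
  rcases eq_or_ne δ 0 with rfl | hδ0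
  · rw [zero_add] at hω' ⊢
    exact hlam.add γ η hη hγ hd' hω' n
  · rw [hlam.add δ η hη hδ0 hδ (le_add_self.trans_lt hω') n]
    rw [← add_assoc] at hω' ⊢
    rw [hlam.add (γ + δ) η hη (by simp [hγ]) (dvd_add hd' hδ) hω' n, add_assoc]

/-- Both sides obey the same recursion in `β`: a set and its set of block minima have the same
minimum, so the admissibility bounds agree, and at limits `lam_add` matches the approximating
sequences. -/
theorem schreier_add {γ ξ : Ordinal.{0}} (hγ : γ ≠ 0) (hd : ω ^ ξ ∣ γ)
    (hω : γ + ω ^ ξ < ω_ 1) {β : Ordinal.{0}} (hβ : β < ω ^ ξ) :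
    schreier lam (γ + β) = blockUnion (schreier lam β) (schreier lam γ) := by
  have hγω : γ < ω_ 1 := (le_self_add (a := γ)).trans_lt hω
  have h0 := empty_mem_schreier hlam hγω
  have hmin : ∀ (E : Finset ℕ+) (g : ℕ+ → ℕ+),
      (∀ e ∈ E, g e ∈ E ∧ g e ≤ e ∧ g (g e) = g e) → ∀ n : ℕ+,
      (∀ e ∈ E.image g, n ≤ e) ↔ ∀ e ∈ E, n ≤ e := by
    intro E g hg n
    rw [Finset.forall_mem_image]
    exact ⟨fun h e he => (h he).trans (hg e he).2.1, fun h e he => h _ (hg e he).1⟩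
  induction β using Ordinal.limitRecOn with
  | zero =>
    rw [add_zero]
    ext E
    constructor
    · intro hE
      rcases E.eq_empty_or_nonempty with rfl | hne
      · exact ⟨id, by simp, by simp, by simp [schreier_zero], by simpa using h0⟩
      · refine ⟨fun _ => E.min' hne, fun e he => ⟨E.min'_mem hne, E.min'_le e he, rfl⟩,
          fun _ _ _ _ _ => le_rfl, ?_, fun h =>
            isHereditary_schreier lam γ E hE _ (Finset.filter_subset _ _)⟩
        rw [schreier_zero, Finset.image_const hne]
        exact Or.inr ⟨_, rfl⟩
    · rintro ⟨g, h1, h2, h3, h4⟩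
      rw [schreier_zero] at h3
      rcases h3 with h3 | ⟨n, h3⟩
      · rwa [Finset.image_eq_empty.1 h3]
      · have h5 := h4 n
        rwa [Finset.filter_true_of_mem fun e he => by
          simpa [h3] using Finset.mem_image_of_mem g he] at h5
  | add_one β ih =>
    have ih := ih ((lt_add_one β).trans hβ)
    ext E
    rw [← add_assoc, mem_schreier_add_one, ih]
    simp only [succUnion_blockUnion h0]
    constructor
    · rintro ⟨n, ⟨g, h1, h2, h3, h4⟩, hn⟩
      exact ⟨g, h1, h2, mem_schreier_add_one.2 ⟨n, h3, Finset.forall_mem_image.2 fun e he =>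
        hn _ (h1 e he).1⟩, h4⟩
    · rintro ⟨g, h1, h2, h3, h4⟩
      obtain ⟨n, hn, hn'⟩ := mem_schreier_add_one.1 h3
      exact ⟨n, ⟨g, h1, h2, hn, h4⟩, fun e he =>
        (hn' _ (Finset.mem_image_of_mem g he)).trans (h1 e he).2.1⟩
  | limit β hl ih =>
    have hβω : β < ω_ 1 := hβ.trans (le_add_self.trans_lt hω)
    have hlt := hlam.lt β hβω hl
    have hl' : Order.IsSuccLimit (γ + β) := isSuccLimit_add_iff.2 (Or.inl hl)
    ext E
    rw [schreier_limit _ _ hl']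
    simp only [hlam.lam_add hγ hd hω hβ hl]
    constructor
    · rintro ⟨k, hk, -, hE⟩
      rw [ih _ (hlt k) ((hlt k).trans hβ)] at hE
      obtain ⟨g, h1, h2, h3, h4⟩ := hE
      refine ⟨g, h1, h2, ?_, h4⟩
      rw [schreier_limit _ _ hl]
      exact ⟨k, (hmin E g h1 k).2 hk, hlt k, h3⟩
    · rintro ⟨g, h1, h2, h3, h4⟩
      rw [schreier_limit _ _ hl] at h3
      obtain ⟨k, hk, -, hE⟩ := h3
      refine ⟨k, (hmin E g h1 k).1 hk, by simpa using hlt k, ?_⟩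
      rw [ih _ (hlt k) ((hlt k).trans hβ)]
      exact ⟨g, h1, h2, hE, h4⟩

/-- Nesting is assumed only for powers of `ω`. For `α = γ + ω ^ ξ` it transfers because `blockUnion`
is monotone in the family of minima. -/
theorem schreier_lam_mono {α : Ordinal.{0}} (hα : α < ω_ 1) (hl : Order.IsSuccLimit α)
    {k m : ℕ+} (hkm : k ≤ m) : schreier lam (lam α k) ⊆ schreier lam (lam α m) := by
  have step : ∀ n, schreier lam (lam α n) ⊆ schreier lam (lam α (n + 1)) := by
    intro n
    obtain ⟨γ, ξ, hξ, hd, rfl⟩ := exists_eq_add_opow_of_isSuccLimit α hl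
    have hξω : ω ^ ξ < ω_ 1 := le_add_self.trans_lt hα
    rcases eq_or_ne γ 0 with rfl | hγ
    · rw [zero_add]
      exact hlam.nested ξ hξ hξω n
    · have hξl : Order.IsSuccLimit (ω ^ ξ) := by
        rcases isSuccLimit_add_iff.1 hl with h | h
        · exact h
        · exact absurd h.1 (opow_pos _ omega0_pos).ne'
      rw [hlam.add γ ξ hξ hγ hd hα, hlam.add γ ξ hξ hγ hd hα,
        schreier_add hlam hγ hd hα (hlam.lt _ hξω hξl n),
        schreier_add hlam hγ hd hα (hlam.lt _ hξω hξl (n + 1))]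
      exact blockUnion_mono (hlam.nested ξ hξ hξω n) _
  induction m using PNat.recOn with
  | one =>
    obtain rfl : k = 1 := le_antisymm hkm one_le
    exact subset_rfl
  | succ m ih =>
    rcases hkm.eq_or_lt with rfl | h
    · exact subset_rfl
    · exact (ih (PNat.lt_add_one_iff.1 h)).trans (step m)

end nested

/-! ### Thinness, and descent from limit orders to successor orders. -/

section descent

variable {lam : Ordinal.{0} → ℕ+ → Ordinal.{0}}

/-- Beyond a set outside `S`, a set outside of `succUnion S m` gives one outside of
`succUnion S (m + 1)`. -/
theorem union_notMem_succUnion {S : Set (Finset ℕ+)} (hS : IsHereditary S) {E₁ E₂ : Finset ℕ+}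
    {m : ℕ} (h₁ : E₁ ∉ S) (h₂ : E₂ ∉ succUnion S m) (hlt : SetLT E₁ E₂) :
    E₁ ∪ E₂ ∉ succUnion S (m + 1) := by
  rintro ⟨A, hA, B, hB, hAB, heq⟩
  have : ¬ E₁ ⊆ A := fun h => h₁ (hS A hA _ h)
  obtain ⟨e, he, heA⟩ := Finset.not_subset.1 this
  have heB : e ∈ B := by
    have : e ∈ A ∪ B := heq ▸ Finset.mem_union_left _ he
    exact (Finset.mem_union.1 this).resolve_left heA
  refine h₂ (hS.succUnion m B hB _ fun x hx => ?_)
  have : x ∈ A ∪ B := heq ▸ Finset.mem_union_right _ hx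
  exact (Finset.mem_union.1 this).resolve_left fun hxA =>
    lt_asymm (hAB x hxA e heB) (hlt e he x hx)

/-- No infinite set has all its finite subsets in a family with this property. -/
def IsThin (S : Set (Finset ℕ+)) : Prop :=
  ∀ X : Set ℕ+, X.Infinite → ∃ E : Finset ℕ+, (E : Set ℕ+) ⊆ X ∧ E ∉ S

theorem IsThin.succUnion {S : Set (Finset ℕ+)} (hS : IsHereditary S) (hT : IsThin S) (m : ℕ) :
    IsThin (succUnion S m) := by
  induction m with
  | zero =>
    intro X hX
    obtain ⟨x, hx⟩ := hX.nonempty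
    exact ⟨{x}, by simpa using hx, by simp [_root_.succUnion]⟩
  | succ m ih =>
    intro X hX
    obtain ⟨E₁, h1, h2⟩ := hT X hX
    obtain ⟨E₂, h3, h4⟩ := ih _ (hX.inter_Ioi (E₁.sup id))
    refine ⟨E₁ ∪ E₂, ?_, union_notMem_succUnion hS h2 h4 fun a ha b hb =>
      (Finset.le_sup (f := id) ha).trans_lt (h3 hb).2⟩
    rw [Finset.coe_union]
    exact Set.union_subset h1 (h3.trans Set.inter_subset_left)

/-- Adjoining an early element `x` of `X` caps the number of pieces, or the index of the
approximating family, at `x`; induction then supplies a set that breaks this cap. -/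
theorem isThin_schreier (hlam : IsAdmissible lam) {α : Ordinal.{0}} (hα : α < ω_ 1) :
    IsThin (schreier lam α) := by
  induction α using Ordinal.limitRecOn with
  | zero =>
    intro X hX
    obtain ⟨x, hx⟩ := hX.nonempty
    obtain ⟨y, hy, hxy⟩ := (hX.inter_Ioi x).nonempty
    refine ⟨{x, y}, by simp [Set.insert_subset_iff, hx, hy], ?_⟩
    rw [schreier_zero]
    rintro (h | ⟨n, h⟩)
    · simp at h
    · have h1 : x ∈ ({n} : Finset ℕ+) := h ▸ by simp
      have h2 : y ∈ ({n} : Finset ℕ+) := h ▸ by simp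
      rw [Finset.mem_singleton] at h1 h2
      exact absurd (h1.trans h2.symm) (ne_of_lt hxy)
  | add_one γ ih =>
    intro X hX
    have hγ := (lt_add_one γ).trans hα
    obtain ⟨x, hx⟩ := hX.nonempty
    obtain ⟨E, hE, hE'⟩ := (ih hγ).succUnion (isHereditary_schreier lam γ) x _ (hX.inter_Ioi x)
    refine ⟨insert x E, ?_, fun h => hE' ?_⟩
    · rw [Finset.coe_insert, Set.insert_subset_iff]
      exact ⟨hx, hE.trans Set.inter_subset_left⟩
    · obtain ⟨n, hn, hn'⟩ := mem_schreier_add_one.1 h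
      exact (isHereditary_schreier lam γ).succUnion x _ (succUnion_mono
        (empty_mem_schreier hlam hγ) (hn' x (by simp)) hn) _ (Finset.subset_insert x E)
  | limit α hl ih =>
    intro X hX
    obtain ⟨x, hx⟩ := hX.nonempty
    have hlt := hlam.lt α hα hl x
    obtain ⟨E, hE, hE'⟩ := ih _ hlt (hlt.trans hα) _ hX
    refine ⟨insert x E, ?_, fun h => hE' ?_⟩
    · rw [Finset.coe_insert, Set.insert_subset_iff]
      exact ⟨hx, hE⟩
    · rw [schreier_limit _ _ hl] at h
      obtain ⟨k, hk, -, h⟩ := h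
      exact isHereditary_schreier lam _ _ (schreier_lam_mono hlam hα hl (hk x (by simp)) h) _
        (Finset.subset_insert x E)

/-- A minimal nonmember of `S` splits into two members, itself without its maximum and that maximum.
So each obstruction costs two pieces, whence `2 * m + 1`. -/
theorem exists_notMem_succUnion {S : Set (Finset ℕ+)} (hS : IsHereditary S) (hT : IsThin S)
    (h0 : ∅ ∈ S) (h1 : ∀ n, {n} ∈ S) (m : ℕ) (X : Set ℕ+) (hX : X.Infinite) :
    ∃ E : Finset ℕ+, (E : Set ℕ+) ⊆ X ∧ E ∉ succUnion S m ∧ E ∈ succUnion S (2 * m + 1) := by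
  induction m generalizing X with
  | zero =>
    obtain ⟨x, hx⟩ := hX.nonempty
    refine ⟨{x}, by simpa using hx, by simp [succUnion], {x}, h1 x, ∅, rfl, by simp [SetLT],
      by simp⟩
  | succ m ih =>
    obtain ⟨E, hE, hES⟩ := hT X hX
    have hmin : ∃ E₁ ⊆ E, E₁ ∉ S ∧ ∀ E' ⊂ E₁, E' ∈ S := by
      clear hE
      induction E using Finset.strongInduction with
      | H E ih =>
        by_cases h : ∀ E' ⊂ E, E' ∈ S
        · exact ⟨E, subset_rfl, hES, h⟩
        · push Not at h
          obtain ⟨E', hE', hE'S⟩ := h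
          obtain ⟨E₁, h2, h3⟩ := ih E' hE' hE'S
          exact ⟨E₁, h2.trans hE'.1, h3⟩
    obtain ⟨E₁, hE₁, hE₁S, hE₁m⟩ := hmin
    have hne : E₁.Nonempty := Finset.nonempty_iff_ne_empty.2 fun h => hE₁S (h ▸ h0)
    set x := E₁.max' hne with hx
    obtain ⟨E₂, h3, h4, h5⟩ := ih _ (hX.inter_Ioi x)
    have hlt : SetLT E₁ E₂ := fun a ha b hb => (Finset.le_max' _ _ ha).trans_lt (h3 hb).2
    refine ⟨E₁ ∪ E₂, ?_, union_notMem_succUnion hS hE₁S h4 hlt, ?_⟩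
    · rw [Finset.coe_union]
      exact Set.union_subset ((Finset.coe_subset.2 hE₁).trans hE) (h3.trans Set.inter_subset_left)
    · refine ⟨E₁.erase x, hE₁m _ (Finset.erase_ssubset (E₁.max'_mem hne)), {x} ∪ E₂,
        ⟨{x}, h1 x, E₂, h5, ?_, rfl⟩, ?_, ?_⟩
      · simp only [SetLT, Finset.mem_singleton, forall_eq]
        exact fun b hb => (h3 hb).2
      · intro a ha b hb
        have hax : a < x := Finset.lt_max'_of_mem_erase_max' E₁ hne ha
        rcases Finset.mem_union.1 hb with hb | hb
        · exact (Finset.mem_singleton.1 hb) ▸ hax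
        · exact hax.trans (h3 hb).2
      · rw [← Finset.union_assoc, Finset.union_comm (E₁.erase x), ← Finset.insert_eq,
          Finset.insert_erase (E₁.max'_mem hne)]

/-- If `S_δ` contains the members of `S_{β+1}` with minimum `m`, then the repeated averages of
order `δ` of sets with minimum `m` are repeated averages of some fixed order `δ' + 1 > β`. -/
theorem exists_isRepeatedAverage_add_one (hlam : IsAdmissible lam) {β δ : Ordinal.{0}}
    (hβ : β < ω_ 1) (hδ : δ < ω_ 1) {m : ℕ+} (hm : 2 ≤ m)
    (hsub : ∀ E ∈ schreier lam (β + 1), m ∈ E → (∀ e ∈ E, m ≤ e) → E ∈ schreier lam δ) :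
    ∃ δ' : Ordinal.{0}, β ≤ δ' ∧ δ' < δ ∧ ∀ (C : Finset ℕ+) (z : ℕ+ → ℝ) (hC : C.Nonempty),
      C.min' hC = m → IsRepeatedAverage lam δ C z → IsRepeatedAverage lam (δ' + 1) C z := by
  have hsing : ∀ E ∈ schreier lam β, (∀ e ∈ E, m < e) → insert m E ∈ schreier lam (β + 1) := by
    intro E hE hmE
    refine mem_schreier_add_one.2 ⟨2, ⟨{m}, singleton_mem_schreier hlam hβ m, E,
      ⟨E, hE, ∅, rfl, by simp [SetLT], by simp⟩, by simpa [SetLT] using hmE, by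
        rw [Finset.insert_eq]⟩, fun e he => ?_⟩
    rcases Finset.mem_insert.1 he with rfl | he
    · exact_mod_cast hm
    · exact_mod_cast hm.trans (hmE e he).le
  have hle : ∀ (E : Finset ℕ+), (∀ e ∈ E, m < e) → ∀ e ∈ insert m E, m ≤ e := by
    intro E hmE e he
    rcases Finset.mem_insert.1 he with rfl | he
    · exact le_rfl
    · exact (hmE e he).le
  induction δ using Ordinal.limitRecOn with
  | zero =>
    have h1 := hsub _ (hsing {m + 1} (singleton_mem_schreier hlam hβ _)
      (by simp)) (by simp) (hle _ (by simp))
    rw [schreier_zero] at h1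
    rcases h1 with h1 | ⟨n, h1⟩
    · simp at h1
    · have h2 : m ∈ ({n} : Finset ℕ+) := h1 ▸ by simp
      have h3 : m + 1 ∈ ({n} : Finset ℕ+) := h1 ▸ by simp
      rw [Finset.mem_singleton] at h2 h3
      exact absurd (h2.trans h3.symm) (PNat.lt_add_right m 1).ne
  | add_one γ _ =>
    have hγ := (lt_add_one γ).trans hδ
    rcases le_or_gt β γ with h | h
    · exact ⟨γ, h, lt_add_one γ, fun C z _ _ hz => hz⟩
    -- If `γ < β`, take `E` far out which needs more than `m` pieces from `S_γ` but at most `2 * m +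
    -- 1`. Then `E` is in `S_{γ+1}`, hence in `S_β`, and `{m} ∪ E` is in `S_{β+1}`; but minimum `m`
    -- allows only `m` pieces in `S_{γ+1}`.
    exfalso
    obtain ⟨n₀, hn₀⟩ := exists_schreier_subset hlam hβ (Order.add_one_le_of_lt h)
    set S := schreier lam γ
    have hS : IsHereditary S := isHereditary_schreier lam γ
    have h0 := empty_mem_schreier hlam hγ
    let k : ℕ+ := ⟨2 * m + 1, by omega⟩
    obtain ⟨E, hE, hE1, hE2⟩ := exists_notMem_succUnion hS (isThin_schreier hlam hγ)
      h0 (singleton_mem_schreier hlam hγ) m _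
      (Set.infinite_univ.inter_Ioi (max n₀ (max m k)))
    have hgt : ∀ e ∈ E, max n₀ (max m k) < e := fun e he => (hE he).2
    have hmE : ∀ e ∈ E, m < e := fun e he =>
      ((le_max_left _ _).trans (le_max_right _ _)).trans_lt (hgt e he)
    have hEβ : E ∈ schreier lam β := hn₀ E (mem_schreier_add_one.2 ⟨2 * m + 1, hE2, fun e he => by
      have : k < e := ((le_max_right _ _).trans (le_max_right _ _)).trans_lt (hgt e he)
      exact_mod_cast this.le⟩) fun e he => ((le_max_left _ _).trans_lt (hgt e he)).le
    obtain ⟨n, hn, hn'⟩ := mem_schreier_add_one.1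
      (hsub _ (hsing E hEβ hmE) (by simp) (hle E hmE))
    exact hE1 (hS.succUnion m _ (succUnion_mono h0 (hn' m (by simp)) hn) _
      (Finset.subset_insert m E))
  | limit δ hl ih =>
    have hlt := hlam.lt δ hδ hl m
    -- Sets of `S_δ` containing `m` lie in `S_{lam δ k}` with `k ≤ m`, hence in `S_{lam δ m}`, so
    -- the inclusion survives the descent.
    obtain ⟨δ', h1, h2, h3⟩ := ih _ hlt (hlt.trans hδ) fun E hE hmE hE' => by
      have := hsub E hE hmE hE'
      rw [schreier_limit _ _ hl] at this
      obtain ⟨k, hk, -, h⟩ := this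
      exact schreier_lam_mono hlam hδ hl (hk m hmE) h
    refine ⟨δ', h1, h2.trans hlt, fun C z hC hm hz => h3 C z hC hm ?_⟩
    obtain ⟨_, -, hz⟩ := (isRepeatedAverage_limit lam δ hl C z).1 hz
    rwa [hm] at hz

end descent

/-! ### Repeated averages: total weight, uniqueness of values, averaging estimates. -/

section repeatedAverage

variable {lam : Ordinal.{0} → ℕ+ → Ordinal.{0}}

theorem IsRepeatedAverage.properties {α : Ordinal.{0}} {C : Finset ℕ+} {z : ℕ+ → ℝ}
    (h : IsRepeatedAverage lam α C z) : C.Nonempty ∧ C ∈ schreier lam α ∧ (∀ a, 0 ≤ z a) ∧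
      (∀ a ∉ C, z a = 0) ∧ ∑ a ∈ C, z a ≤ 1 := by
  induction α using Ordinal.limitRecOn generalizing C z with
  | zero =>
    obtain ⟨n, rfl, rfl⟩ := (isRepeatedAverage_zero lam C z).1 h
    refine ⟨by simp, by simp [schreier_zero], fun a => ?_, fun a ha => ?_, by simp⟩
    · by_cases h : a = n
      · subst h; simp
      · simp [h]
    · simp only [Finset.mem_singleton] at ha
      simp [ha]
  | add_one γ ih =>
    obtain ⟨n, P, w, hP, hmax, ⟨hC, hn⟩, hw, rfl⟩ := (isRepeatedAverage_add_one lam γ C z).1 h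
    have ih' := fun j => ih (hw j)
    have hn0 : (0 : ℝ) < n := by
      rw [hn]; exact_mod_cast (C.min' hC).2
    have hPC : ∀ j, P j ⊆ C := fun j => by
      rw [hP.2.2]; exact Finset.subset_biUnion_of_mem P (Finset.mem_univ j)
    refine ⟨hC, ?_, fun a => mul_nonneg (by positivity)
      (Finset.sum_nonneg fun j _ => (ih' j).2.2.1 a), fun a ha => ?_, ?_⟩
    · rw [schreier_add_one]
      exact ⟨n, P, hP, fun j => (hmax j).1, fun e he => by
        rw [hn]; exact_mod_cast C.min'_le e he⟩
    · change 1 / (n : ℝ) * ∑ j, w j a = 0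
      rw [Finset.sum_eq_zero fun j _ => (ih' j).2.2.2.1 a fun h => ha (hPC j h), mul_zero]
    · rw [← Finset.mul_sum, Finset.sum_comm]
      have : ∑ j, ∑ a ∈ C, w j a ≤ ∑ _j : Fin n, (1 : ℝ) := Finset.sum_le_sum fun j _ => by
        rw [← Finset.sum_subset (hPC j) fun a _ ha => (ih' j).2.2.2.1 a ha]
        exact (ih' j).2.2.2.2
      rw [Finset.sum_const, Finset.card_univ, Fintype.card_fin, _root_.nsmul_eq_mul, mul_one] at this
      rw [one_div, inv_mul_le_iff₀ hn0, mul_one]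
      exact this
  | limit α hl ih =>
    obtain ⟨hC, hlt, hz⟩ := (isRepeatedAverage_limit lam α hl C z).1 h
    obtain ⟨h1, h2, h3⟩ := ih _ hlt hz
    refine ⟨h1, ?_, h3⟩
    rw [schreier_limit _ _ hl]
    exact ⟨C.min' hC, fun e he => C.min'_le e he, hlt, h2⟩

theorem IsRepeatedAverage.sum_le_one {α : Ordinal.{0}} {C A : Finset ℕ+} {z : ℕ+ → ℝ}
    (h : IsRepeatedAverage lam α C z) : ∑ a ∈ A, z a ≤ 1 := by
  obtain ⟨-, -, h3, h4, h5⟩ := h.properties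
  calc ∑ a ∈ A, z a ≤ ∑ a ∈ A ∪ C, z a :=
        Finset.sum_le_sum_of_subset_of_nonneg Finset.subset_union_left fun a _ _ => h3 a
    _ = ∑ a ∈ C, z a := (Finset.sum_subset Finset.subset_union_right fun a _ ha => h4 a ha).symm
    _ ≤ 1 := h5

theorem min'_eq_min' {C C' : Finset ℕ+} (hC : C.Nonempty) (hC' : C'.Nonempty) {a : ℕ+}
    (ha : a ∈ C) (ha' : a ∈ C') (h : ∀ x ≤ a, x ∈ C ↔ x ∈ C') : C.min' hC = C'.min' hC' := by
  apply le_antisymm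
  · exact C.min'_le _ ((h _ (C'.min'_le a ha')).2 (C'.min'_mem hC'))
  · exact C'.min'_le _ ((h _ (C.min'_le a ha)).1 (C.min'_mem hC))

/-- The value of the repeated average at `a` is determined by the elements up to `a`. -/
theorem IsRepeatedAverage.apply_eq {α : Ordinal.{0}} {C C' : Finset ℕ+} {z z' : ℕ+ → ℝ}
    (h : IsRepeatedAverage lam α C z) (h' : IsRepeatedAverage lam α C' z')
    (hC : C ∈ maximalSets (schreier lam α)) (hC' : C' ∈ maximalSets (schreier lam α))
    {a : ℕ+} (ha : a ∈ C) (ha' : a ∈ C') (heq : ∀ x ≤ a, x ∈ C ↔ x ∈ C') : z a = z' a := by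
  induction α using Ordinal.limitRecOn generalizing C C' z z' with
  | zero =>
    obtain ⟨n, rfl, rfl⟩ := (isRepeatedAverage_zero lam C z).1 h
    obtain ⟨n', rfl, rfl⟩ := (isRepeatedAverage_zero lam C' z').1 h'
    rw [Finset.mem_singleton] at ha ha'
    rw [← ha, ← ha']
  | add_one γ ih =>
    obtain ⟨n, P, w, ⟨hP1, hP2, rfl⟩, hmax, ⟨hne, hn⟩, hw, rfl⟩ :=
      (isRepeatedAverage_add_one lam γ C z).1 h
    obtain ⟨n', P', w', ⟨hP1', hP2', rfl⟩, hmax', ⟨hne', hn'⟩, hw', rfl⟩ :=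
      (isRepeatedAverage_add_one lam γ C' z').1 h'
    obtain rfl : n = n' := by rw [hn, hn', min'_eq_min' hne hne' ha ha' heq]
    simp only [Finset.mem_biUnion, Finset.mem_univ, true_and] at ha ha' heq
    obtain ⟨i, hi⟩ := ha
    obtain ⟨i', hi'⟩ := ha'
    -- a block whose elements come before `a` is an initial segment of the other block
    have sub : ∀ (P P' : Fin n → Finset ℕ+), (∀ i j, i < j → SetLT (P i) (P j)) →
        (∀ i j, i < j → SetLT (P' i) (P' j)) → (∀ x ≤ a, (∃ j, x ∈ P j) ↔ ∃ j, x ∈ P' j) →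
        ∀ l, (∀ k < l, P k = P' k) → ∀ y ∈ P' l, y ≤ a → (∀ x ∈ P l, x ≤ y) →
        IsInitialSegment (P l) (P' l) := by
      intro P P' h2 h2' heq l hk y hy hya hxy
      have aux : ∀ x ∈ P l, x ∈ P' l := by
        intro x hx
        obtain ⟨j, hj⟩ := (heq x ((hxy x hx).trans hya)).1 ⟨l, hx⟩
        rcases lt_trichotomy j l with hjl | rfl | hjl
        · rw [← hk j hjl] at hj
          exact absurd (h2 j l hjl x hj x hx) (lt_irrefl x)
        · exact hj
        · exact absurd (h2' l j hjl y hy x hj) (hxy x hx).not_gt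
      refine ⟨aux, fun b hb c hc hcb => ?_⟩
      obtain ⟨j, hj⟩ := (heq c (hcb.trans ((hxy b hb).trans hya))).2 ⟨l, hc⟩
      rcases lt_trichotomy j l with hjl | rfl | hjl
      · rw [hk j hjl] at hj
        exact absurd (h2' j l hjl c hj c hc) (lt_irrefl c)
      · exact hj
      · exact absurd (h2 l j hjl b hb c hj) hcb.not_gt
    -- Of the two `k`-th blocks, the one with the smaller maximum is an initial segment of the
    -- other; maximality makes them equal.
    have blocks : ∀ m : ℕ, ∀ k : Fin n, (k : ℕ) < m → k < i → k < i' → P k = P' k := by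
      intro m
      induction m with
      | zero => intro k hk; exact absurd hk (Nat.not_lt_zero _)
      | succ m ihm =>
        intro k hk hki hki'
        have hprev : ∀ l < k, P l = P' l := fun l hl =>
          ihm l (lt_of_lt_of_le hl (Nat.lt_succ_iff.1 hk)) (hl.trans hki) (hl.trans hki')
        rcases le_total ((P k).max' (hP1 k)) ((P' k).max' (hP1' k)) with hle | hle
        · exact ((hmax k).2 _ (hmax' k).1 (sub P P' hP2 hP2' heq k hprev _
            ((P' k).max'_mem (hP1' k)) (hP2' k i' hki' _ ((P' k).max'_mem _) a hi').le
            fun x hx => ((P k).le_max' x hx).trans hle)).symm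
        · exact (hmax' k).2 _ (hmax k).1 (sub P' P hP2' hP2 (fun x hx => (heq x hx).symm) k
            (fun l hl => (hprev l hl).symm) _ ((P k).max'_mem (hP1 k))
            (hP2 k i hki _ ((P k).max'_mem _) a hi).le
            fun x hx => ((P' k).le_max' x hx).trans hle)
    -- If `a` lay in an earlier block on one side, the other side's block of that index would end
    -- before `a` and, by maximality, equal a block containing `a`.
    have hii : i = i' := by
      rcases lt_trichotomy i i' with hlt | h | hlt
      · exfalso
        have := (hmax' i).2 _ (hmax i).1 (sub P' P hP2' hP2 (fun x hx => (heq x hx).symm) i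
          (fun l hl => (blocks (l + 1) l (Nat.lt_succ_self _) hl (hl.trans hlt)).symm) a hi le_rfl
          fun x hx => (hP2' i i' hlt x hx a hi').le)
        exact absurd (hP2' i i' hlt a (this ▸ hi) a hi') (lt_irrefl a)
      · exact h
      · exfalso
        have := (hmax i').2 _ (hmax' i').1 (sub P P' hP2 hP2' heq i'
          (fun l hl => blocks (l + 1) l (Nat.lt_succ_self _) (hl.trans hlt) hl) a hi' le_rfl
          fun x hx => (hP2 i' i hlt x hx a hi).le)
        exact absurd (hP2 i' i hlt a (this ▸ hi') a hi) (lt_irrefl a)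
    subst hii
    have hsingle : ∀ (P : Fin n → Finset ℕ+) (w : Fin n → ℕ+ → ℝ),
        (∀ i j, i < j → SetLT (P i) (P j)) → (∀ j, IsRepeatedAverage lam γ (P j) (w j)) →
        a ∈ P i → ∑ j, w j a = w i a := fun P w h2 hw hi =>
      Finset.sum_eq_single i (fun j _ hj => (hw j).properties.2.2.2.1 a fun hmem => by
        rcases lt_or_gt_of_ne hj with h | h
        · exact lt_irrefl a (h2 j i h a hmem a hi)
        · exact lt_irrefl a (h2 i j h a hi a hmem)) (by simp)
    change 1 / (n : ℝ) * ∑ j, w j a = 1 / (n : ℝ) * ∑ j, w' j a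
    rw [hsingle P w hP2 hw hi, hsingle P' w' hP2' hw' hi']
    congr 1
    refine ih (hw i) (hw' i) (hmax i) (hmax' i) hi hi' fun x hx => ?_
    have hprev : ∀ l < i, P l = P' l := fun l hl => blocks (l + 1) l (Nat.lt_succ_self _) hl hl
    constructor
    · intro hxi
      obtain ⟨j, hj⟩ := (heq x hx).1 ⟨i, hxi⟩
      rcases lt_trichotomy j i with hji | rfl | hji
      · rw [← hprev j hji] at hj
        exact absurd (hP2 j i hji x hj x hxi) (lt_irrefl x)
      · exact hj
      · exact absurd (hP2' i j hji a hi' x hj) hx.not_gt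
    · intro hxi
      obtain ⟨j, hj⟩ := (heq x hx).2 ⟨i, hxi⟩
      rcases lt_trichotomy j i with hji | rfl | hji
      · rw [hprev j hji] at hj
        exact absurd (hP2' j i hji x hj x hxi) (lt_irrefl x)
      · exact hj
      · exact absurd (hP2 i j hji a hi x hj) hx.not_gt
  | limit α hl ih =>
    obtain ⟨hne, hlt, hz⟩ := (isRepeatedAverage_limit lam α hl C z).1 h
    obtain ⟨hne', hlt', hz'⟩ := (isRepeatedAverage_limit lam α hl C' z').1 h'
    -- An extension has the same minimum, so extending `C` within `S_{lam α (min C)}` would extend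
    -- it within `S_α`.
    have hmaxl : ∀ (C : Finset ℕ+) (hne : C.Nonempty), C ∈ maximalSets (schreier lam α) →
        lam α (C.min' hne) < α → C ∈ schreier lam (lam α (C.min' hne)) →
        C ∈ maximalSets (schreier lam (lam α (C.min' hne))) := by
      refine fun C hne hmax hlt hmem => ⟨hmem, fun B hB hCB => hmax.2 B ?_ hCB⟩
      rw [schreier_limit _ _ hl]
      refine ⟨C.min' hne, fun e he => ?_, hlt, hB⟩
      by_contra hcon
      exact absurd (C.min'_le e (hCB.2 _ (C.min'_mem hne) e he (not_le.1 hcon).le)) hcon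
    have hmin := min'_eq_min' hne hne' ha ha' heq
    have h1 := hmaxl C hne hC hlt hz.properties.2.1
    have h2 := hmaxl C' hne' hC' hlt' hz'.properties.2.1
    rw [← hmin] at h2 hz'
    exact ih _ hlt hz hz' h1 h2 ha ha' heq

theorem isZetaValue_unique {α : Ordinal.{0}} {A : Finset ℕ+} {c c' : ℝ}
    (h : IsZetaValue lam α A c) (h' : IsZetaValue lam α A c') : c = c' := by
  obtain ⟨B, z, hA, hB, hAB, hz, rfl⟩ := h
  obtain ⟨B', z', _, hB', hAB', hz', rfl⟩ := h'
  have hm := A.max'_mem hA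
  exact hz.apply_eq hz' hB hB' (hAB.1 hm) (hAB'.1 hm) fun x hx =>
    ⟨fun h => hAB'.1 (hAB.2 _ hm x h hx), fun h => hAB.1 (hAB'.2 _ hm x h hx)⟩

theorem schreierZeta_eq {α : Ordinal.{0}} {A : Finset ℕ+} {c : ℝ} (h : IsZetaValue lam α A c) :
    schreierZeta lam α A = c := by
  have hex : ∃ c, IsZetaValue lam α A c := ⟨c, h⟩
  rw [schreierZeta, dif_pos hex]
  exact isZetaValue_unique hex.choose_spec h

/-- If all but few of the blocks `P j` carry little of the weight of `A`, then `A` has small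
weight. -/
theorem sum_average_le {γ : Ordinal.{0}} {n : ℕ} (hn : 0 < n) {P : Fin n → Finset ℕ+}
    {w : Fin n → ℕ+ → ℝ} (hw : ∀ j, IsRepeatedAverage lam γ (P j) (w j)) (A : Finset ℕ+)
    {ε : ℝ} (hε : 0 ≤ ε) (J : Finset (Fin n)) (hJ : ∀ j ∉ J, ∑ a ∈ A ∩ P j, w j a ≤ ε) :
    ∑ a ∈ A, (1 / (n : ℝ)) * ∑ j, w j a ≤ ε + J.card / n := by
  have hn0 : (0 : ℝ) < n := by exact_mod_cast hn
  rw [← Finset.mul_sum, Finset.sum_comm]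
  have h1 : ∀ j, ∑ a ∈ A, w j a ≤ ε + if j ∈ J then 1 else 0 := by
    intro j
    split_ifs with h
    · linarith [(hw j).sum_le_one (A := A)]
    · rw [← Finset.sum_subset (Finset.inter_subset_left (s₁ := A) (s₂ := P j)), add_zero]
      · exact hJ j h
      · exact fun a ha ha' => (hw j).properties.2.2.2.1 a fun h =>
          ha' (Finset.mem_inter.2 ⟨ha, h⟩)
  have h2 := Finset.sum_le_sum fun j (_ : j ∈ Finset.univ) => h1 j
  rw [Finset.sum_add_distrib, Finset.sum_const, Finset.card_univ, Fintype.card_fin,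
    _root_.nsmul_eq_mul, Finset.sum_ite_mem, Finset.univ_inter, Finset.sum_const, _root_.nsmul_eq_mul,
    mul_one] at h2
  rw [one_div, inv_mul_le_iff₀ hn0]
  refine h2.trans_eq ?_
  field_simp

/-- A repeated average gives little weight to `A` if the blocks not containing the minimum do. -/
theorem IsRepeatedAverage.sum_le_add_inv {γ : Ordinal.{0}} {C A : Finset ℕ+} {z : ℕ+ → ℝ}
    (hz : IsRepeatedAverage lam (γ + 1) C z) (hC : C.Nonempty) {ε : ℝ} (hε : 0 ≤ ε)
    (h : ∀ P w, IsRepeatedAverage lam γ P w → P ⊆ C → C.min' hC ∉ P →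
      ∑ a ∈ A ∩ P, w a ≤ ε) : ∑ a ∈ A, z a ≤ ε + 1 / (C.min' hC : ℕ) := by
  obtain ⟨n, P, w, hP, -, ⟨_, hn⟩, hw, rfl⟩ := (isRepeatedAverage_add_one lam γ C z).1 hz
  have hPC : ∀ j, P j ⊆ C := fun j => by
    rw [hP.2.2]; exact Finset.subset_biUnion_of_mem P (Finset.mem_univ j)
  let J : Finset (Fin n) := {j | C.min' hC ∈ P j}
  have hJ : J.card ≤ 1 := Finset.card_le_one.2 fun i hi j hj => by
    simp only [J, Finset.mem_filter, Finset.mem_univ, true_and] at hi hj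
    rcases lt_trichotomy i j with h | h | h
    · exact absurd (hP.2.1 i j h _ hi _ hj) (lt_irrefl _)
    · exact h
    · exact absurd (hP.2.1 j i h _ hj _ hi) (lt_irrefl _)
  have hn0 : 0 < n := hn ▸ (C.min' hC).2
  have h7 := sum_average_le hn0 hw A hε J fun j hj => by
    simp only [J, Finset.mem_filter, Finset.mem_univ, true_and] at hj
    exact h (P j) (w j) (hw j) (hPC j) hj
  have h8 : (J.card : ℝ) / n ≤ 1 / n := by
    gcongr
    exact_mod_cast hJ
  rw [← hn]
  exact h7.trans (by linarith)

/-! ### Families of rank at most `ω ^ α` have small weight. -/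

theorem exists_lt_notMem_derivedFamily {F : Set (Finset ℕ+)} {M : Set ℕ+} {β : Ordinal.{0}}
    (hβ : Order.IsSuccLimit β) (h : ∅ ∉ derivedFamily F M β) :
    ∃ γ < β, ∅ ∉ derivedFamily F M γ := by
  by_contra! hcon
  refine h (mem_derivedFamily.2 ⟨?_, fun γ hγ => ?_⟩)
  · exact (mem_derivedFamily.1 (hcon 0 hβ.bot_lt)).1
  · exact (mem_derivedFamily.1 (hcon (γ + 1) (hβ.add_one_lt hγ))).2 γ (lt_add_one γ)

theorem IsInitialSegment.inter {D C P : Finset ℕ+} (h : IsInitialSegment D C) (hP : P ⊆ C) :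
    IsInitialSegment (D ∩ P) P :=
  ⟨Finset.inter_subset_right, fun a ha b hb hba => Finset.mem_inter.2
    ⟨h.2 a (Finset.mem_inter.1 ha).1 b (hP hb) hba, hb⟩⟩

theorem IsInitialSegment.min'_mem {D C A : Finset ℕ+} (h : IsInitialSegment D C) (hAD : A ⊆ D)
    (hA : A.Nonempty) (hC : C.Nonempty) : C.min' hC ∈ D := by
  obtain ⟨a, ha⟩ := hA
  exact h.2 a (hAD ha) _ (C.min'_mem hC) (C.min'_le a (h.1 (hAD ha)))

theorem exists_pnat_div_lt (c : ℝ) {ε : ℝ} (hε : 0 < ε) :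
    ∃ m : ℕ+, ∀ n : ℕ+, m ≤ n → c / (n : ℕ) < ε := by
  obtain ⟨m, hm⟩ := exists_nat_gt (c / ε)
  refine ⟨m.succPNat, fun n hn => ?_⟩
  have hn0 : (0 : ℝ) < (n : ℕ) := by exact_mod_cast n.2
  have h1 : (m : ℝ) < (n : ℕ) := by
    have : m.succPNat.val ≤ (n : ℕ) := hn
    rw [Nat.succPNat_coe] at this
    exact_mod_cast this
  rw [div_lt_iff₀ hε] at hm
  rw [div_lt_iff₀ hn0]
  nlinarith

/-- A hereditary family of rank at most `ω ^ α` contains, on a suitable infinite set, only sets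
of small weight with respect to the repeated averages of order `α`. -/
theorem exists_infinite_sum_lt (hlam : IsAdmissible lam) {α : Ordinal.{0}} (hα : α < ω_ 1)
    {F : Set (Finset ℕ+)} (hF : IsHereditary F) {M : Set ℕ+} (hM : M.Infinite)
    (h : ∅ ∉ derivedFamily F M (ω ^ α)) {ε : ℝ} (hε : 0 < ε) :
    ∃ N ⊆ M, N.Infinite ∧ ∀ (C : Finset ℕ+) (z : ℕ+ → ℝ) (D A : Finset ℕ+),
      IsRepeatedAverage lam α C z → IsInitialSegment D C → (D : Set ℕ+) ⊆ N → A ⊆ D → A ∈ F →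
        ∑ a ∈ A, z a < ε := by
  induction α using WellFoundedLT.induction generalizing F M ε with
  | ind α ih =>
  rcases Ordinal.zero_or_succ_or_isSuccLimit α with rfl | ⟨γ, rfl⟩ | hl
  · rw [opow_zero] at h
    by_cases h0 : ∅ ∈ F
    · have hfin : {n | n ∈ M ∧ {n} ∈ F}.Finite := by
        by_contra hinf
        refine h (mem_derivedFamily.2 ⟨h0, fun γ hγ => ?_⟩)
        obtain rfl : γ = 0 := by simpa using hγ
        simpa [derivedFamily_zero] using hinf
      refine ⟨M \ {n | n ∈ M ∧ {n} ∈ F}, Set.sdiff_subset, hM.sdiff hfin, ?_⟩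
      intro C z D A hz hD hDN hAD hA
      obtain ⟨n, rfl, rfl⟩ := (isRepeatedAverage_zero lam C z).1 hz
      rcases Finset.subset_singleton_iff.1 (hAD.trans hD.1) with rfl | rfl
      · simpa using hε
      · have hn := hDN (hAD (Finset.mem_singleton_self n))
        exact absurd ⟨hn.1, hA⟩ hn.2
    · exact ⟨M, subset_rfl, hM, fun C z D A _ _ _ _ hA =>
        absurd (hF A hA ∅ (Finset.empty_subset A)) h0⟩
  · rw [Order.succ_eq_add_one] at *
    have hγ := (lt_add_one γ).trans hα
    obtain ⟨δ, hδ, hδF⟩ := exists_lt_notMem_derivedFamily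
      (isSuccLimit_opow_left isSuccLimit_omega0 (by simp)) h
    rw [opow_add, opow_one, lt_mul_iff_of_isSuccLimit isSuccLimit_omega0] at hδ
    obtain ⟨c, hc, hδc⟩ := hδ
    obtain ⟨k, rfl⟩ := lt_omega0.1 hc
    have hk : ∅ ∉ derivedFamily F M (ω ^ γ * k) := fun h =>
      hδF (derivedFamily_anti F M hδc.le h)
    -- Pairs of a heavy set and the initial segment containing it: heaviness concerns the first
    -- component, lying in `N` the second.
    let L : Set (Finset ℕ+ × Finset ℕ+) := {p | ∃ C z, IsRepeatedAverage lam γ C z ∧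
      IsInitialSegment p.2 C ∧ p.1 ⊆ p.2 ∧ ε / 2 ≤ ∑ a ∈ p.1, z a}
    obtain ⟨N, hNM, hN, hNL⟩ := exists_infinite_avoiding_unions L
      (by rintro p ⟨C, z, -, -, h, -⟩; exact h)
      (by
        rintro p ⟨C, z, -, -, -, h⟩
        rw [Finset.nonempty_iff_ne_empty]
        intro h0
        rw [h0, Finset.sum_empty] at h
        linarith) (ω ^ γ)
      (fun F M hF hM h => by
        obtain ⟨N, h1, h2, h3⟩ := ih γ (lt_add_one γ) hγ hF hM h (half_pos hε)
        refine ⟨N, h1, h2, ?_⟩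
        rintro ⟨A, D⟩ ⟨C, z, h4, h5, h6, h7⟩ h8 h9
        exact absurd (h3 C z D A h4 h5 h8 h6 h9) (not_lt.2 h7)) k F M hF hM hk
    obtain ⟨m, hm⟩ := exists_pnat_div_lt k (half_pos hε)
    refine ⟨N ∩ Set.Ioi m, Set.inter_subset_left.trans hNM, hN.inter_Ioi m, ?_⟩
    intro C z D A hz hD hDN hAD hA
    rcases A.eq_empty_or_nonempty with rfl | hAne
    · simpa using hε
    obtain ⟨n, P, w, hP, -, ⟨hC, hn⟩, hw, rfl⟩ := (isRepeatedAverage_add_one lam γ C z).1 hz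
    have hmn : m < C.min' hC := (hDN (hD.min'_mem hAD hAne hC)).2
    have hPC : ∀ j, P j ⊆ C := fun j => by
      rw [hP.2.2]; exact Finset.subset_biUnion_of_mem P (Finset.mem_univ j)
    let J : Finset (Fin n) := {j | ε / 2 < ∑ a ∈ A ∩ P j, w j a}
    -- Otherwise the traces of `A` on the heavy blocks give at least `k` successive members of `L`
    -- whose union, a subset of `A`, is in `F`.
    have hJ : J.card ≤ k := by
      by_contra! hcard
      let q : Fin n → Finset ℕ+ × Finset ℕ+ := fun j => (A ∩ P j, D ∩ P j)
      refine hNL (((List.finRange n).filter (· ∈ J)).map q) ?_ ?_ ?_ ?_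
        (hF A hA _ (unionFst_subset ?_))
      · rw [List.length_map]
        refine hcard.le.trans_eq ?_
        have : ((List.finRange n).filter (· ∈ J)).toFinset = J := by ext; simp
        rw [← this, List.toFinset_card_of_nodup ((List.nodup_finRange n).filter _)]
        simp [this]
      · intro p hp
        obtain ⟨j, hj, rfl⟩ := List.mem_map.1 hp
        have hj : ε / 2 < ∑ a ∈ A ∩ P j, w j a := by simpa [J] using hj
        exact ⟨P j, w j, hw j, hD.inter (hPC j), Finset.inter_subset_inter_right hAD, hj.le⟩
      · intro p hp x hx
        obtain ⟨j, -, rfl⟩ := List.mem_map.1 hp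
        exact (hDN (Finset.mem_inter.1 hx).1).1
      · rw [List.pairwise_map]
        refine ((List.pairwise_lt_finRange n).filter _).imp fun {i j} hij a ha b hb => ?_
        exact hP.2.1 i j hij a (Finset.mem_inter.1 ha).2 b (Finset.mem_inter.1 hb).2
      · intro p hp
        obtain ⟨j, -, rfl⟩ := List.mem_map.1 hp
        exact Finset.inter_subset_left
    have hn0 : 0 < n := hn ▸ (C.min' hC).2
    have h1 := sum_average_le hn0 hw A (half_pos hε).le J (by simp [J])
    have h2 : (J.card : ℝ) / n ≤ k / n := by gcongr
    have h3 : (k : ℝ) / n < ε / 2 := by rw [hn]; exact hm _ hmn.le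
    exact h1.trans_lt (by linarith)
  · obtain ⟨δ, hδ, hδF⟩ := exists_lt_notMem_derivedFamily
      (isSuccLimit_opow one_lt_omega0 hl) h
    obtain ⟨β, hβ, hδβ⟩ := (lt_opow_of_isSuccLimit omega0_ne_zero hl).1 hδ
    have hβF : ∀ δ', β ≤ δ' → ∀ N ⊆ M, ∅ ∉ derivedFamily F N (ω ^ δ') := fun δ' h' N hN h =>
      hδF (derivedFamily_mono_set F hN _ (derivedFamily_anti F N
        (hδβ.le.trans (opow_le_opow_right omega0_pos h')) h))
    obtain ⟨k, hk⟩ := hlam.exists_lt_lam hα hl (hl.add_one_lt hβ)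
    obtain ⟨n₀, hn₀⟩ := exists_schreier_subset hlam ((hlam.lt α hα hl k).trans hα) hk.le
    obtain ⟨m₁, hm₁⟩ := exists_pnat_div_lt 1 (half_pos hε)
    set m₀ := max (max n₀ k) (max 2 m₁) with hm₀
    -- The successor order reached from `lam α m` depends on `m`, so the induction hypothesis is
    -- applied separately for each possible minimum `m` and the resulting sets are diagonalized.
    let R : ℕ+ → Set ℕ+ → Prop := fun m N => m₀ ≤ m → ∀ (C : Finset ℕ+) (z : ℕ+ → ℝ)
      (D A : Finset ℕ+) (hC : C.Nonempty), C.min' hC = m → IsRepeatedAverage lam α C z →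
      IsInitialSegment D C → (D : Set ℕ+) ⊆ insert m N → A ⊆ D → A ∈ F →
        ∑ a ∈ A, z a ≤ ε / 2 + 1 / (m : ℕ)
    obtain ⟨N, hNM, hN, hNR⟩ := exists_diagonal M hM R
      (fun m N N' hN h hm C z D A hC hCm hz hD hDN =>
        h hm C z D A hC hCm hz hD (hDN.trans (Set.insert_subset_insert hN))) (by
        intro m N hNM hN
        by_cases hm : m₀ ≤ m
        swap
        · exact ⟨N, subset_rfl, hN, fun h => absurd h hm⟩
        have hn₀m : n₀ ≤ m := ((le_max_left _ _).trans (le_max_left _ _)).trans hm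
        have hkm : k ≤ m := ((le_max_right _ _).trans (le_max_left _ _)).trans hm
        have h2m : 2 ≤ m := ((le_max_left _ _).trans (le_max_right _ _)).trans hm
        have hlt := hlam.lt α hα hl m
        obtain ⟨δ', h1, h2, h3⟩ := exists_isRepeatedAverage_add_one hlam (hβ.trans hα)
          (hlt.trans hα) h2m (fun E hE _ hE' => schreier_lam_mono hlam hα hl hkm
            (hn₀ E hE fun e he => hn₀m.trans (hE' e he)))
        obtain ⟨N', h4, h5, h6⟩ := ih δ' (h2.trans hlt) (h2.trans (hlt.trans hα)) hF hN
          (hβF δ' h1 N hNM) (half_pos hε)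
        refine ⟨N', h4, h5, fun _ C z D A hC hCm hz hD hDN hAD hA => ?_⟩
        obtain ⟨_, -, hz⟩ := (isRepeatedAverage_limit lam α hl C z).1 hz
        rw [hCm] at hz
        -- The blocks missing `m` meet `D` inside `N'` and are light by induction; the one block
        -- containing `m` costs at most `1 / m`.
        have h7 := (h3 C z hC hCm hz).sum_le_add_inv hC (half_pos hε).le (A := A)
          fun P w hw hPC hP => (h6 P w (D ∩ P) (A ∩ P) hw (hD.inter hPC) (fun x hx => by
            obtain ⟨hxD, hxP⟩ := Finset.mem_inter.1 hx
            exact (hDN hxD).resolve_left fun h => hP (by rwa [hCm, ← h]))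
            (Finset.inter_subset_inter_right hAD) (hF A hA _ Finset.inter_subset_left)).le
        rwa [hCm] at h7)
    refine ⟨N ∩ Set.Ioi m₀, Set.inter_subset_left.trans hNM, hN.inter_Ioi m₀, ?_⟩
    intro C z D A hz hD hDN hAD hA
    rcases A.eq_empty_or_nonempty with rfl | hAne
    · simpa using hε
    have hC := hz.properties.1
    have hmin := hDN (hD.min'_mem hAD hAne hC)
    have h1 := hNR _ hmin.1 hmin.2.le C z D A hC rfl hz hD (fun x hx => by
      rcases (C.min'_le x (hD.1 hx)).eq_or_lt with h | h
      · exact Or.inl h.symm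
      · exact Or.inr ⟨(hDN hx).1, h⟩) hAD hA
    have h2 := hm₁ (C.min' hC) (((le_max_right _ _).trans (le_max_right _ _)).trans hmin.2.le)
    linarith

end repeatedAverage

/-! ### Weak-star derivatives of the dual ball and the rank of the norming family. -/

section weakDerived

variable {𝕜 X : Type*} [RCLike 𝕜] [NormedAddCommGroup X] [NormedSpace 𝕜 X]

variable (𝕜 X) in
/-- A weak-star closed variant of the Szlenk derivatives of the dual unit ball: `f` survives if
every weak-star neighbourhood of `f` meets all earlier sets in sets of diameter greater
than `ε`. -/
def weakDerived (ε : ℝ) (β : Ordinal.{0}) : Set (WeakDual 𝕜 X) :=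
  {f | WeakDual.toStrongDual f ∈ Metric.closedBall (0 : StrongDual 𝕜 X) 1 ∧ ∀ γ, γ < β →
    ∀ U ∈ 𝓝 f, ∃ g ∈ weakDerived ε γ, g ∈ U ∧ ∃ h ∈ weakDerived ε γ, h ∈ U ∧
      ε < ‖WeakDual.toStrongDual g - WeakDual.toStrongDual h‖}
termination_by β

theorem mem_weakDerived {ε : ℝ} {β : Ordinal.{0}} {f : WeakDual 𝕜 X} :
    f ∈ weakDerived 𝕜 X ε β ↔
      WeakDual.toStrongDual f ∈ Metric.closedBall (0 : StrongDual 𝕜 X) 1 ∧ ∀ γ < β,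
        ∀ U ∈ 𝓝 f, ∃ g ∈ weakDerived 𝕜 X ε γ, g ∈ U ∧ ∃ h ∈ weakDerived 𝕜 X ε γ, h ∈ U ∧
          ε < ‖WeakDual.toStrongDual g - WeakDual.toStrongDual h‖ := by
  rw [weakDerived]; rfl

theorem weakDerived_anti {ε : ℝ} {β γ : Ordinal.{0}} (h : β ≤ γ) :
    weakDerived 𝕜 X ε γ ⊆ weakDerived 𝕜 X ε β := by
  intro f hf
  rw [mem_weakDerived] at hf ⊢
  exact ⟨hf.1, fun δ hδ => hf.2 δ (hδ.trans_le h)⟩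

/-- A neighbourhood of a limit point is also a neighbourhood of a member. Closedness yields
compactness, which provides the cluster points and nested intersections below. -/
theorem isClosed_weakDerived (ε : ℝ) (β : Ordinal.{0}) : IsClosed (weakDerived 𝕜 X ε β) := by
  refine isClosed_of_closure_subset fun f hf => mem_weakDerived.2 ⟨?_, fun γ hγ U hU => ?_⟩
  · exact closure_minimal (fun g hg => (mem_weakDerived.1 hg).1)
      (WeakDual.isClosed_closedBall (0 : StrongDual 𝕜 X) 1) hf
  · obtain ⟨V, hVU, hV, hfV⟩ := mem_nhds_iff.1 hU
    obtain ⟨f', hf'V, hf'⟩ := mem_closure_iff.1 hf V hV hfV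
    obtain ⟨g, hg, hgV, h, hh, hhV, hlt⟩ :=
      (mem_weakDerived.1 hf').2 γ hγ V (hV.mem_nhds hf'V)
    exact ⟨g, hg, hVU hgV, h, hh, hVU hhV, hlt⟩

theorem isCompact_weakDerived (ε : ℝ) (β : Ordinal.{0}) : IsCompact (weakDerived 𝕜 X ε β) :=
  (WeakDual.isCompact_closedBall (0 : StrongDual 𝕜 X) 1).of_isClosed_subset
    (isClosed_weakDerived ε β) fun _ hf => (mem_weakDerived.1 hf).1

/-- Of two functionals more than `2 * ε` apart, one is more than `ε` from `f`. Separability makes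
the ball weak-star metrizable, so these functionals yield a sequence tending to `f`. -/
theorem weakDerived_subset_szlenkDerived [TopologicalSpace.SeparableSpace X] (ε : ℝ)
    (β : Ordinal.{0}) (f : WeakDual 𝕜 X) (hf : f ∈ weakDerived 𝕜 X (2 * ε) β) :
    WeakDual.toStrongDual f ∈
      szlenkDerived (Metric.closedBall (0 : StrongDual 𝕜 X) 1) ε β := by
  induction β using Ordinal.limitRecOn generalizing f with
  | zero =>
    rw [szlenkDerived_zero]
    exact (mem_weakDerived.1 hf).1
  | add_one β ih =>
    rw [szlenkDerived_add_one]
    let K : Set (WeakDual 𝕜 X) := WeakDual.toStrongDual ⁻¹' Metric.closedBall 0 1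
    have hmetr : TopologicalSpace.MetrizableSpace K :=
      WeakDual.metrizable_of_isCompact 𝕜 X K (WeakDual.isCompact_closedBall 0 1)
    let S : Set K := {g | (g : WeakDual 𝕜 X) ∈ weakDerived 𝕜 X (2 * ε) β ∧
      ε < ‖WeakDual.toStrongDual (g : WeakDual 𝕜 X) - WeakDual.toStrongDual f‖}
    have hmem : (⟨f, (mem_weakDerived.1 hf).1⟩ : K) ∈ closure S := by
      rw [closure_subtype, mem_closure_iff_nhds]
      intro U hU
      obtain ⟨g, hg, hgU, h, hh, hhU, hlt⟩ :=
        (mem_weakDerived.1 hf).2 β (lt_add_one β) U hU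
      have htri := norm_sub_le_norm_sub_add_norm_sub (WeakDual.toStrongDual g)
        (WeakDual.toStrongDual f) (WeakDual.toStrongDual h)
      rw [norm_sub_rev (WeakDual.toStrongDual f)] at htri
      rcases lt_or_ge ε ‖WeakDual.toStrongDual g - WeakDual.toStrongDual f‖ with h1 | h1
      · exact ⟨g, hgU, ⟨g, (mem_weakDerived.1 hg).1⟩, ⟨hg, h1⟩, rfl⟩
      · refine ⟨h, hhU, ⟨h, (mem_weakDerived.1 hh).1⟩, ⟨hh, ?_⟩, rfl⟩
        change ε < ‖WeakDual.toStrongDual h - WeakDual.toStrongDual f‖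
        linarith
    obtain ⟨u, hu, hlim⟩ := mem_closure_iff_seq_limit.1 hmem
    refine ⟨fun n => WeakDual.toStrongDual (u n : WeakDual 𝕜 X), fun n => ih _ (hu n).1,
      fun x => ?_, fun n => (hu n).2⟩
    have h1 : Continuous fun g : K => (g : WeakDual 𝕜 X) x :=
      (WeakDual.eval_continuous x).comp continuous_subtype_val
    exact (h1.tendsto _).comp hlim
  | limit β hl ih =>
    rw [szlenkDerived_limit _ _ _ hl]
    exact Set.mem_iInter₂.2 fun γ hγ => ih γ hγ f (weakDerived_anti hγ.le hf)

/-- The functional `f` is at least `δ` on some member of `t p q` whenever `p < a < q` in `A`. -/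
def NormsBetween (t : ℕ+ → ℕ+ → Finset X) (δ : ℝ) (A : Finset ℕ+) (f : WeakDual 𝕜 X) : Prop :=
  ∀ p ∈ A, ∀ a ∈ A, ∀ q ∈ A, p < a → a < q → ∃ y ∈ t p q, δ ≤ ‖f y‖

theorem NormsBetween.mono {t : ℕ+ → ℕ+ → Finset X} {δ : ℝ} {A B : Finset ℕ+}
    {f : WeakDual 𝕜 X} (h : NormsBetween t δ A f) (hB : B ⊆ A) : NormsBetween t δ B f :=
  fun p hp a ha q hq => h p (hB hp) a (hB ha) q (hB hq)

theorem isClosed_normsBetween (t : ℕ+ → ℕ+ → Finset X) (δ : ℝ) (A : Finset ℕ+) :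
    IsClosed {f : WeakDual 𝕜 X | NormsBetween t δ A f} := by
  have : {f : WeakDual 𝕜 X | NormsBetween t δ A f} = ⋂ p ∈ A, ⋂ a ∈ A, ⋂ q ∈ A,
      ⋂ (_ : p < a), ⋂ (_ : a < q), ⋃ y ∈ t p q, {f : WeakDual 𝕜 X | δ ≤ ‖f y‖} := by
    ext f
    simp [NormsBetween]
  rw [this]
  exact isClosed_biInter fun p _ => isClosed_biInter fun a _ => isClosed_biInter fun q _ =>
    isClosed_iInter fun _ => isClosed_iInter fun _ => (t p q).finite_toSet.isClosed_biUnion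
      fun y _ => isClosed_le continuous_const (WeakDual.eval_continuous y).norm

variable (𝕜) in
/-- The family of sets for which some functional in the unit ball is large between any two
elements that are not neighbours. -/
def normingFamily (t : ℕ+ → ℕ+ → Finset X) (δ : ℝ) : Set (Finset ℕ+) :=
  {A | ∃ f : WeakDual 𝕜 X, WeakDual.toStrongDual f ∈ Metric.closedBall (0 : StrongDual 𝕜 X) 1 ∧
    NormsBetween t δ A f}

theorem isHereditary_normingFamily (t : ℕ+ → ℕ+ → Finset X) (δ : ℝ) :
    IsHereditary (normingFamily 𝕜 t δ) :=
  fun _ ⟨f, hf, hA⟩ _ hB => ⟨f, hf, hA.mono hB⟩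

theorem Set.Infinite.exists_gt_pnat {S : Set ℕ+} (hS : S.Infinite) (k : ℕ+) : ∃ n ∈ S, k < n := by
  obtain ⟨n, hn⟩ := (hS.inter_Ioi k).nonempty
  exact ⟨n, hn.1, hn.2⟩

/-- Three derivations of the family pay for one of the ball, since a norming condition involves
three elements `p < a < q`. Carrying `NormsBetween t δ A` along keeps the induction going; it passes
to cluster points because the sets `t p q` are finite. -/
theorem exists_mem_weakDerived (t : ℕ+ → ℕ+ → Finset X) {δ : ℝ} (hδ : 0 < δ)
    (hnorm : ∀ p q, ∀ y ∈ t p q, ‖y‖ ≤ 1)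
    (hsmall : ∀ (f : StrongDual 𝕜 X) (η : ℝ), 0 < η → ∃ n₀, ∀ n ≥ n₀, ∀ q, ∀ y ∈ t n q,
      ‖f y‖ < η) (M : Set ℕ+) (β : Ordinal.{0}) (A : Finset ℕ+)
    (hA : A ∈ derivedFamily (normingFamily 𝕜 t δ) M (3 * β)) :
    ∃ f ∈ weakDerived 𝕜 X (δ / 4) β, NormsBetween t δ A f := by
  have hcpt : ∀ γ, IsCompact (weakDerived 𝕜 X (δ / 4) γ ∩ {f | NormsBetween t δ A f}) :=
    fun γ => (isCompact_weakDerived _ γ).inter_right (isClosed_normsBetween t δ A)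
  induction β using Ordinal.limitRecOn generalizing A with
  | zero =>
    rw [mul_zero, derivedFamily_zero] at hA
    obtain ⟨f, hf, hfA⟩ := hA
    exact ⟨f, mem_weakDerived.2 ⟨hf, fun γ hγ => absurd hγ not_lt_zero⟩, hfA⟩
  | add_one β ih =>
    have h3 : (3 : Ordinal.{0}) = 1 + 1 + 1 := by norm_num
    have hmul : 3 * (β + 1) = 3 * β + 1 + 1 + 1 := by
      rw [mul_add_one]
      nth_rewrite 2 [h3]
      simp only [add_assoc]
    rw [hmul] at hA
    have hstep : ∀ k : ℕ+, ∃ f ∈ weakDerived 𝕜 X (δ / 4) β, NormsBetween t δ A f ∧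
        ∃ n ≥ k, ∃ l, ∃ y ∈ t n l, δ ≤ ‖f y‖ := by
      intro k
      obtain ⟨n, ⟨-, hn⟩, hkn⟩ :=
        ((mem_derivedFamily.1 hA).2 _ (lt_add_one _)).exists_gt_pnat k
      obtain ⟨m, ⟨-, hm⟩, hnm⟩ :=
        ((mem_derivedFamily.1 hn).2 _ (lt_add_one _)).exists_gt_pnat n
      obtain ⟨l, ⟨-, hl⟩, hml⟩ :=
        ((mem_derivedFamily.1 hm).2 _ (lt_add_one _)).exists_gt_pnat m
      obtain ⟨f, hf, hfA⟩ := ih _ hl fun γ =>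
        (isCompact_weakDerived _ γ).inter_right (isClosed_normsBetween t δ _)
      refine ⟨f, hf, hfA.mono fun x hx => by simp [hx], n, hkn.le, l, ?_⟩
      exact hfA n (by simp) m (by simp) l (by simp) hnm hml
    choose f hf hfA n hkn l y hy hfy using hstep
    -- For large `k`, `g` is below `δ / 2` on the vector `y k`, where `f k` is at least `δ`; hence
    -- `f k` and `g` are more than `δ / 4` apart, and both lie in `U` for suitable such `k`.
    obtain ⟨g, hg, hclus⟩ := (hcpt β).exists_mapClusterPt_of_frequently (l := atTop) (f := f)
      (Filter.Frequently.of_forall fun k => ⟨hf k, hfA k⟩)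
    refine ⟨g, mem_weakDerived.2 ⟨(mem_weakDerived.1 hg.1).1, fun γ hγ U hU => ?_⟩, hg.2⟩
    have hγβ : γ ≤ β := Order.lt_add_one_iff.1 hγ
    obtain ⟨n₀, hn₀⟩ := hsmall (WeakDual.toStrongDual g) (δ / 2) (half_pos hδ)
    obtain ⟨k, hkU, hk⟩ := ((mapClusterPt_iff_frequently.1 hclus U hU).and_eventually
      (eventually_ge_atTop n₀)).exists
    refine ⟨f k, weakDerived_anti hγβ (hf k), hkU, g, weakDerived_anti hγβ hg.1,
      mem_of_mem_nhds hU, ?_⟩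
    have h1 : ‖g (y k)‖ < δ / 2 := hn₀ (n k) (hk.trans (hkn k)) (l k) (y k) (hy k)
    have h2 : ‖(WeakDual.toStrongDual (f k) - WeakDual.toStrongDual g) (y k)‖ ≤
        ‖WeakDual.toStrongDual (f k) - WeakDual.toStrongDual g‖ :=
      ((WeakDual.toStrongDual (f k) - WeakDual.toStrongDual g).le_opNorm (y k)).trans
        (mul_le_of_le_one_right (norm_nonneg _) (hnorm _ _ _ (hy k)))
    have h3 : ‖(f k) (y k)‖ - ‖g (y k)‖ ≤
        ‖(WeakDual.toStrongDual (f k) - WeakDual.toStrongDual g) (y k)‖ :=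
      norm_sub_norm_le (f k (y k)) (g (y k))
    linarith [hfy k]
  | limit β hl ih =>
    have hne : ∀ γ : {γ // γ < β},
        (weakDerived 𝕜 X (δ / 4) γ.1 ∩ {f | NormsBetween t δ A f}).Nonempty := by
      rintro ⟨γ, hγ⟩
      obtain ⟨f, hf, hfA⟩ := ih γ hγ A
        (derivedFamily_anti _ M (mul_le_mul_right hγ.le 3) hA) hcpt
      exact ⟨f, hf, hfA⟩
    have : Nonempty {γ // γ < β} := ⟨⟨0, hl.bot_lt⟩⟩
    obtain ⟨f, hf⟩ := IsCompact.nonempty_iInter_of_directed_nonempty_isCompact_isClosed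
      (fun γ : {γ // γ < β} => weakDerived 𝕜 X (δ / 4) γ.1 ∩ {f | NormsBetween t δ A f})
      (fun γ₁ γ₂ => ⟨max γ₁ γ₂,
        Set.inter_subset_inter_left _ (weakDerived_anti (le_max_left γ₁ γ₂)),
        Set.inter_subset_inter_left _ (weakDerived_anti (le_max_right γ₁ γ₂))⟩) hne
      (fun γ => hcpt γ) (fun γ => (isClosed_weakDerived _ _).inter (isClosed_normsBetween t δ A))
    rw [Set.mem_iInter] at hf
    refine ⟨f, mem_weakDerived.2 ⟨(mem_weakDerived.1 (hf ⟨0, hl.bot_lt⟩).1).1,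
      fun γ hγ => ?_⟩, (hf ⟨0, hl.bot_lt⟩).2⟩
    exact (mem_weakDerived.1 (hf ⟨γ + 1, hl.add_one_lt hγ⟩).1).2 γ (lt_add_one γ)

end weakDerived

/-! ### Strict lower bounds for the Szlenk index. -/

section szlenk

variable {𝕜 X : Type*} [RCLike 𝕜] [NormedAddCommGroup X] [NormedSpace 𝕜 X]

/-- Averaging with a fixed `h` preserves weak-star convergence and the ball, and halves distances.
-/
theorem half_add_mem_szlenkDerived {ε : ℝ} {β : Ordinal.{0}} {f h : StrongDual 𝕜 X}
    (hf : f ∈ szlenkDerived (Metric.closedBall (0 : StrongDual 𝕜 X) 1) ε β)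
    (hh : h ∈ Metric.closedBall (0 : StrongDual 𝕜 X) 1) :
    (2⁻¹ : 𝕜) • (f + h) ∈
      szlenkDerived (Metric.closedBall (0 : StrongDual 𝕜 X) 1) (ε / 2) β := by
  have h2 : ‖(2⁻¹ : 𝕜)‖ = 2⁻¹ := by simp
  induction β using Ordinal.limitRecOn generalizing f with
  | zero =>
    rw [szlenkDerived_zero, mem_closedBall_zero_iff] at *
    rw [norm_smul, h2]
    linarith [norm_add_le f h]
  | add_one β ih =>
    rw [szlenkDerived_add_one] at *
    obtain ⟨u, hu, hlim, hnorm⟩ := hf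
    refine ⟨fun n => (2⁻¹ : 𝕜) • (u n + h), fun n => ih (hu n), fun x => ?_, fun n => ?_⟩
    · exact ((hlim x).add_const (h x)).const_smul (2⁻¹ : 𝕜)
    · have e : (2⁻¹ : 𝕜) • (u n + h) - (2⁻¹ : 𝕜) • (f + h) = (2⁻¹ : 𝕜) • (u n - f) := by
        module
      refine lt_of_lt_of_eq ?_ (congrArg norm e).symm
      rw [norm_smul, h2]
      linarith [hnorm n]
  | limit β hl ih =>
    rw [szlenkDerived_limit _ _ _ hl] at *
    exact Set.mem_iInter₂.2 fun γ hγ => ih γ hγ (Set.mem_iInter₂.1 hf γ hγ)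

/-- If the dual unit ball has a nonempty derivative of order `β` and nonempty first derivative,
then it has nonempty derivatives of order `β + 1`. -/
theorem szlenkDerived_add_one_nonempty {ε : ℝ} (hε : 0 < ε) {β : Ordinal.{0}}
    {f : StrongDual 𝕜 X} (hf₁ : f ∈ Metric.closedBall (0 : StrongDual 𝕜 X) 1)
    (hf : f ∈ szlenkDerived (Metric.closedBall (0 : StrongDual 𝕜 X) 1) ε β)
    (h1 : (szlenkStep (Metric.closedBall (0 : StrongDual 𝕜 X) 1) ε).Nonempty) :
    (szlenkDerived (Metric.closedBall (0 : StrongDual 𝕜 X) 1) (ε / 2 / 2) (β + 1)).Nonempty := by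
  obtain ⟨g, u, hu, hlim, hnorm⟩ := h1
  -- Averaging with `-f` puts `0` into the derivative of order `β`; averaging `0` with `u n` then
  -- puts there a sequence witnessing one further derivation at `g / 2`.
  have h0 := half_add_mem_szlenkDerived hf (h := -f) (by
    rw [mem_closedBall_zero_iff] at *
    rwa [norm_neg])
  rw [add_neg_cancel, smul_zero] at h0
  refine ⟨(2⁻¹ : 𝕜) • g, ?_⟩
  rw [szlenkDerived_add_one]
  refine ⟨fun n => (2⁻¹ : 𝕜) • u n, fun n => ?_, fun x => (hlim x).const_smul (2⁻¹ : 𝕜),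
    fun n => ?_⟩
  · simpa using half_add_mem_szlenkDerived h0 (hu n)
  · have e : (2⁻¹ : 𝕜) • u n - (2⁻¹ : 𝕜) • g = (2⁻¹ : 𝕜) • (u n - g) := by module
    have h2 : ‖(2⁻¹ : 𝕜)‖ = 2⁻¹ := by simp
    refine lt_of_lt_of_eq ?_ (congrArg norm e).symm
    rw [norm_smul, h2]
    linarith [hnorm n]

theorem le_szlenkIndex {ε : ℝ} (hε : 0 < ε) {β : Ordinal.{0}} (hβ : β < ω_ 1)
    (h : (szlenkDerived (Metric.closedBall (0 : StrongDual 𝕜 X) 1) ε β).Nonempty) :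
    β ≤ szlenkIndex 𝕜 X := by
  have h1 : ∀ ε : ℝ, szlenkEta (Metric.closedBall (0 : StrongDual 𝕜 X) 1) ε ≤ ω_ 1 :=
    fun ε => csSup_le' fun γ hγ => hγ.1.le
  have h2 : β ≤ szlenkEta (Metric.closedBall (0 : StrongDual 𝕜 X) 1) ε :=
    le_csSup ⟨ω_ 1, fun γ hγ => hγ.1.le⟩ ⟨hβ, h⟩
  refine h2.trans (le_csSup ⟨ω_ 1, ?_⟩ ⟨ε, hε, rfl⟩)
  rintro _ ⟨ε', -, rfl⟩
  exact h1 ε'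

/-- A nonempty derivative of order `ω ^ α` alone gives only `≤`; the extra derivation makes the
inequality strict. -/
theorem opow_lt_szlenkIndex {ε : ℝ} (hε : 0 < ε) {α : Ordinal.{0}} (hα : α < ω_ 1)
    {f : StrongDual 𝕜 X} (hf₁ : f ∈ Metric.closedBall (0 : StrongDual 𝕜 X) 1)
    (hf : f ∈ szlenkDerived (Metric.closedBall (0 : StrongDual 𝕜 X) 1) ε (ω ^ α))
    (h1 : (szlenkStep (Metric.closedBall (0 : StrongDual 𝕜 X) 1) ε).Nonempty) :
    ω ^ α < szlenkIndex 𝕜 X := by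
  have hω : ω ^ α < ω_ 1 := isPrincipal_opow_omega 1 omega0_lt_omega_one hα
  have hω' : ω ^ α + 1 < ω_ 1 := (Cardinal.isSuccLimit_omega 1).add_one_lt hω
  exact (lt_add_one _).trans_le (le_szlenkIndex (half_pos (half_pos hε)) hω'
    (szlenkDerived_add_one_nonempty hε hf₁ hf h1))

/-- Compose a functional with the complement of a bounded projection onto `V`, and normalize. -/
theorem exists_norm_eq_one_forall_eq_zero (V : Submodule 𝕜 X) [FiniteDimensional 𝕜 V]
    (hX : ¬ FiniteDimensional 𝕜 X) : ∃ f : StrongDual 𝕜 X, ‖f‖ = 1 ∧ ∀ x ∈ V, f x = 0 := by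
  obtain ⟨p, hp⟩ := Submodule.ClosedComplemented.of_finiteDimensional V
  have hV : V ≠ ⊤ := fun h => hX (by
    have : FiniteDimensional 𝕜 (⊤ : Submodule 𝕜 X) := h ▸ ‹_›
    exact Module.Finite.equiv Submodule.topEquiv)
  obtain ⟨x, -, hx⟩ := SetLike.exists_of_lt (lt_top_iff_ne_top.2 hV)
  have hy : x - p x ≠ 0 := fun h => hx (by rw [sub_eq_zero.1 h]; exact (p x).2)
  obtain ⟨g, -, hg⟩ := exists_dual_vector 𝕜 (x - p x) (norm_ne_zero_iff.2 hy)
  let f : StrongDual 𝕜 X := g.comp (ContinuousLinearMap.id 𝕜 X - V.subtypeL.comp p)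
  have hfx : f x ≠ 0 := by
    change g (x - p x) ≠ 0
    rw [hg]
    exact_mod_cast norm_ne_zero_iff.2 hy
  have hf0 : ‖f‖ ≠ 0 := norm_ne_zero_iff.2 fun h => hfx (by rw [h]; rfl)
  refine ⟨((‖f‖⁻¹ : ℝ) : 𝕜) • f, ?_, fun v hv => ?_⟩
  · rw [norm_smul, RCLike.norm_ofReal, abs_of_nonneg (by positivity), inv_mul_cancel₀ hf0]
  · have : f v = 0 := by
      change g (v - p v) = 0
      rw [show (p v : X) = v from congrArg Subtype.val (hp ⟨v, hv⟩), _root_.sub_self, map_zero]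
    simp [this]

/-- Norm-one functionals vanishing on longer and longer initial parts of a dense sequence are
weak-star null. -/
theorem zero_mem_szlenkStep [TopologicalSpace.SeparableSpace X]
    (hX : ¬ FiniteDimensional 𝕜 X) :
    (0 : StrongDual 𝕜 X) ∈ szlenkStep (Metric.closedBall (0 : StrongDual 𝕜 X) 1) 2⁻¹ := by
  let d := TopologicalSpace.denseSeq X
  have hex : ∀ n : ℕ, ∃ f : StrongDual 𝕜 X, ‖f‖ = 1 ∧ ∀ k ≤ n, f (d k) = 0 := fun n => by
    let V := Submodule.span 𝕜 (d '' Set.Iic n)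
    have : FiniteDimensional 𝕜 V := FiniteDimensional.span_of_finite 𝕜 ((Set.finite_Iic n).image d)
    obtain ⟨f, hf, hfV⟩ := exists_norm_eq_one_forall_eq_zero V hX
    exact ⟨f, hf, fun k hk => hfV _ (Submodule.subset_span ⟨k, hk, rfl⟩)⟩
  choose f hf hfd using hex
  refine ⟨f, fun n => by simp [hf], fun x => ?_, fun n => by rw [_root_.sub_zero, hf]; norm_num⟩
  rw [Metric.tendsto_atTop]
  intro η hη
  obtain ⟨k, hk⟩ := (TopologicalSpace.denseRange_denseSeq X).exists_dist_lt x hη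
  refine ⟨k, fun n hn => ?_⟩
  change dist (f n x) 0 < η
  have h1 : f n x = f n (x - d k) := by rw [map_sub, hfd n k hn, _root_.sub_zero]
  rw [dist_zero_right, h1]
  refine ((f n).le_opNorm _).trans_lt ?_
  rwa [hf, one_mul, ← dist_eq_norm]

end szlenk

/-! ### Separability, finite nets and smallness of functionals on tails of an FDD. -/

namespace FDD

variable {𝕜 X : Type*} [RCLike 𝕜] [NormedAddCommGroup X] [NormedSpace 𝕜 X] (F : FDD 𝕜 X)

/-- The span of the first `n` spaces. -/
def initialSpan (n : ℕ+) : Submodule 𝕜 X := ⨆ j ∈ Finset.Icc 1 n, F.space j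

instance (n : ℕ+) : FiniteDimensional 𝕜 (F.initialSpan n) := by
  have := F.finiteDimensional
  exact Submodule.finiteDimensional_finset_sup (Finset.Icc 1 n) F.space |> fun h => by
    rwa [Finset.sup_eq_iSup] at h

theorem sum_coord_mem (x : X) (n : ℕ+) :
    ∑ j ∈ Finset.Icc 1 n, F.coord x j ∈ F.initialSpan n :=
  Submodule.sum_mem _ fun j hj =>
    (le_iSup₂_of_le j hj le_rfl : F.space j ≤ F.initialSpan n) ((F.coord_spec x).1 j)

include F in
theorem separableSpace : TopologicalSpace.SeparableSpace X := by
  have hsep : ∀ n, TopologicalSpace.IsSeparable (F.initialSpan n : Set X) := fun n => by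
    have : ProperSpace (F.initialSpan n) := FiniteDimensional.proper 𝕜 _
    have h := TopologicalSpace.isSeparable_range (f := ((↑) : F.initialSpan n → X))
      continuous_subtype_val
    rwa [Subtype.range_coe] at h
  rw [← TopologicalSpace.isSeparable_univ_iff]
  refine (TopologicalSpace.IsSeparable.iUnion hsep).closure.mono fun x _ => ?_
  exact mem_closure_of_tendsto (F.coord_spec x).2
    (Eventually.of_forall fun n => Set.mem_iUnion.2 ⟨n, F.sum_coord_mem x n⟩)

theorem supp_subset_ran (x : X) : F.supp x ⊆ F.ran x :=
  fun j hj => ⟨j, hj, j, hj, le_rfl, le_rfl⟩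

theorem mem_initialSpan {x : X} {p q : ℕ+} (hx : F.ran x ⊆ Set.Ioo p q) :
    x ∈ F.initialSpan q := by
  have hconst : ∀ n ≥ q, ∑ j ∈ Finset.Icc 1 n, F.coord x j =
      ∑ j ∈ Finset.Icc 1 q, F.coord x j := fun n hn => by
    symm
    refine Finset.sum_subset (Finset.Icc_subset_Icc_right hn) fun j _ hj => ?_
    by_contra hne
    exact hj (Finset.mem_Icc.2 ⟨one_le, (hx (F.supp_subset_ran x hne)).2.le⟩)
  have h : Tendsto (fun n : ℕ+ => ∑ j ∈ Finset.Icc 1 n, F.coord x j) atTop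
      (𝓝 (∑ j ∈ Finset.Icc 1 q, F.coord x j)) :=
    tendsto_const_nhds.congr' ((eventually_ge_atTop q).mono fun n hn => (hconst n hn).symm)
  rw [tendsto_nhds_unique (F.coord_spec x).2 h]
  exact F.sum_coord_mem x q

/-- Vectors with range in `(p, q)` lie in one finite-dimensional space, so those of norm at most one
are totally bounded. -/
theorem exists_finset_net (p q : ℕ+) {η : ℝ} (hη : 0 < η) :
    ∃ t : Finset X, (∀ y ∈ t, ‖y‖ ≤ 1 ∧ F.ran y ⊆ Set.Ioo p q) ∧
      ∀ x : X, ‖x‖ ≤ 1 → F.ran x ⊆ Set.Ioo p q → ∃ y ∈ t, ‖x - y‖ < η := by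
  have : ProperSpace (F.initialSpan q) := FiniteDimensional.proper 𝕜 _
  have hcpt : IsCompact (((↑) : F.initialSpan q → X) '' Metric.closedBall 0 1) :=
    (isCompact_closedBall _ _).image continuous_subtype_val
  have htb : TotallyBounded {x : X | ‖x‖ ≤ 1 ∧ F.ran x ⊆ Set.Ioo p q} :=
    hcpt.totallyBounded.subset fun x hx => (Set.mem_image _ _ _).2
      ⟨⟨x, F.mem_initialSpan hx.2⟩, by simpa using hx.1, rfl⟩
  obtain ⟨t, hts, htf, hcov⟩ := Metric.finite_approx_of_totallyBounded htb η hη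
  refine ⟨htf.toFinset, fun y hy => hts (htf.mem_toFinset.1 hy), fun x hx hx' => ?_⟩
  obtain ⟨y, hy, hxy⟩ := Set.mem_iUnion₂.1 (hcov (Set.mem_ofPred.2 ⟨hx, hx'⟩))
  exact ⟨y, htf.mem_toFinset.2 hy, by rwa [← dist_eq_norm]⟩

variable {F} in
theorem IsShrinking.exists_norm_lt (hF : F.IsShrinking) (f : StrongDual 𝕜 X) {η : ℝ}
    (hη : 0 < η) : ∃ n₀, ∀ n ≥ n₀, ∀ q : ℕ+, ∀ y : X, ‖y‖ ≤ 1 → F.ran y ⊆ Set.Ioo n q →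
      ‖f y‖ < η := by
  by_contra! hcon
  choose N hN q y hy hran hfy using hcon
  -- Restarting each time at the right end `q` of the previous range turns the counterexamples into
  -- a bounded block sequence on which `f` stays at least `η`.
  let k : ℕ → ℕ+ := fun i => Nat.rec 1 (fun _ m => q m) i
  have hk : ∀ i, k (i + 1) = q (k i) := fun i => rfl
  have h0 := hF (fun i => y (k i)) (fun i => ⟨fun h => ?_, fun a ha b hb => ?_⟩)
    ⟨1, fun i => hy _⟩ f
  · obtain ⟨i, hi⟩ := ((tendsto_zero_iff_norm_tendsto_zero.1 h0).eventually_lt_const hη).exists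
    exact absurd hi (hfy (k i)).not_gt
  · have := hfy (k i)
    rw [show y (k i) = 0 from h, map_zero, norm_zero] at this
    linarith
  · have h1 := (hran _ (F.supp_subset_ran _ ha)).2
    have h2 := (hran _ (F.supp_subset_ran _ hb)).1
    have h3 := hN (k (i + 1))
    rw [hk] at h2 h3
    exact h1.trans (h3.trans_lt h2)

end FDD

/-! ### Reduction to one repeated average, and the conclusion. -/

/-- The vectors `∑ ζ(α, {b₁, …, b_j}) x_j` are governed by a single repeated average. -/
theorem sum_schreierZeta_smul {𝕜 X : Type*} [RCLike 𝕜] [NormedAddCommGroup X] [NormedSpace 𝕜 X]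
    (lam : Ordinal.{0} → ℕ+ → Ordinal.{0}) (α : Ordinal.{0}) (B : Finset ℕ+) (x : ℕ+ → X) :
    ∑ b ∈ B, (schreierZeta lam α (B.filter (· ≤ b)) : 𝕜) • x b = 0 ∨
      ∃ (C : Finset ℕ+) (z : ℕ+ → ℝ) (D : Finset ℕ+), IsRepeatedAverage lam α C z ∧
        IsInitialSegment D C ∧ D ⊆ B ∧
        ∑ b ∈ B, (schreierZeta lam α (B.filter (· ≤ b)) : 𝕜) • x b =
          ∑ b ∈ D, (z b : 𝕜) • x b := by
  classical
  -- Beyond the largest element of `G` the coefficient is the default `0`. The average attached to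
  -- that element serves all earlier ones, since values do not depend on the chosen extension.
  let G := B.filter fun b => ∃ c, IsZetaValue lam α (B.filter (· ≤ b)) c
  have hG : ∀ b ∈ B, b ∉ G → schreierZeta lam α (B.filter (· ≤ b)) = 0 := fun b hb hbG =>
    dif_neg fun h => hbG (Finset.mem_filter.2 ⟨hb, h⟩)
  rcases G.eq_empty_or_nonempty with h0 | hne
  · left
    refine Finset.sum_eq_zero fun b hb => ?_
    rw [hG b hb (by simp [h0]), RCLike.ofReal_zero, zero_smul]
  right
  obtain ⟨hmB, c, C, z, _, hC, hDC, hz, -⟩ := Finset.mem_filter.1 (G.max'_mem hne)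
  set m := G.max' hne
  refine ⟨C, z, B.filter (· ≤ m), hz, hDC, Finset.filter_subset _ _, ?_⟩
  symm
  refine Finset.sum_subset_zero_on_sdiff (Finset.filter_subset _ _) (fun b hb => ?_)
    fun b hb => ?_
  · rw [Finset.mem_sdiff, Finset.mem_filter] at hb
    rw [hG b hb.1 fun h => hb.2 ⟨hb.1, G.le_max' b h⟩, RCLike.ofReal_zero, zero_smul]
  · obtain ⟨hbB, hbm⟩ := Finset.mem_filter.1 hb
    have hmem : b ∈ B.filter (· ≤ b) := Finset.mem_filter.2 ⟨hbB, le_rfl⟩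
    have hmax : (B.filter (· ≤ b)).max' ⟨b, hmem⟩ = b :=
      le_antisymm (Finset.max'_le _ _ _ fun y hy => (Finset.mem_filter.1 hy).2)
        (Finset.le_max' _ _ hmem)
    rw [schreierZeta_eq (c := z b) ⟨C, z, ⟨b, hmem⟩, hC, ⟨fun y hy => ?_, fun a ha y hy hya => ?_⟩,
      hz, by rw [hmax]⟩]
    · obtain ⟨h1, h2⟩ := Finset.mem_filter.1 hy
      exact hDC.1 (Finset.mem_filter.2 ⟨h1, h2.trans hbm⟩)
    · obtain ⟨h1, h2⟩ := Finset.mem_filter.1 ha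
      exact Finset.mem_filter.2 ⟨(Finset.mem_filter.1 (hDC.2 a
        (Finset.mem_filter.2 ⟨h1, h2.trans hbm⟩) y hy hya)).1, hya.trans h2⟩

theorem three_mul_omega0_opow {α : Ordinal.{0}} (hα : α ≠ 0) : 3 * ω ^ α = ω ^ α := by
  have h1 : 1 + (α - 1) = α := Ordinal.add_sub_cancel_of_le (Order.one_le_iff_ne_zero.2 hα)
  have h3 : 3 * ω = ω := natCast_mul_omega0 (n := 3) (by norm_num)
  rw [← h1, opow_one_add, ← mul_assoc, h3]

end

/-- In the last line the vectors `x_1, …, x_d` are indexed by the elements `b_1 < … < b_d` of `B`,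
and `{b_1, …, b_j}` is `B.filter (· ≤ b_j)`. -/
theorem theorem7p1 {𝕜 X : Type*} [RCLike 𝕜] [NormedAddCommGroup X] [NormedSpace 𝕜 X]
    [CompleteSpace X] (F : FDD 𝕜 X) (hF : F.IsShrinking)
    (lam : Ordinal.{0} → ℕ+ → Ordinal.{0}) (hlam : IsAdmissible lam)
    (α : Ordinal.{0}) (hα : α < ω_ 1) (hX : α = 0 → ¬ FiniteDimensional 𝕜 X)
    (hSz : szlenkIndex 𝕜 X ≤ ω ^ α) (ε : ℝ) (hε : 0 < ε) (M : Set ℕ+) (hM : M.Infinite) :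
    ∃ N : Set ℕ+, N ⊆ M ∧ N.Infinite ∧
      ∀ B ∈ schreier lam α, (B : Set ℕ+) ⊆ N →
        ∀ x : ℕ+ → X, (∀ b ∈ B, ‖x b‖ ≤ 1) →
          (∀ b ∈ B, F.ran (x b) ⊆ neighbourInterval B b) →
            ‖∑ b ∈ B, (schreierZeta lam α (B.filter (· ≤ b)) : 𝕜) • x b‖ < ε := by
  have := F.separableSpace
  rcases eq_or_ne α 0 with rfl | hα0
  -- The derivative of order `ω ^ 0 = 1` is nonempty, so the index exceeds `1`.
  · have h0 := zero_mem_szlenkStep (hX rfl)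
    refine absurd (opow_lt_szlenkIndex (ε := 2⁻¹) (f := (0 : StrongDual 𝕜 X)) (by norm_num) hα
      (by simp) ?_ ⟨0, h0⟩) hSz.not_gt
    rw [opow_zero, ← zero_add (1 : Ordinal.{0}), szlenkDerived_add_one, szlenkDerived_zero]
    exact h0
  have hε4 : 0 < ε / 4 := by positivity
  choose t ht htnet using fun p q => F.exists_finset_net p q hε4
  have hrank : ∅ ∉ derivedFamily (normingFamily 𝕜 t (ε / 4)) M (ω ^ α) := by
    intro hmem
    rw [← three_mul_omega0_opow hα0] at hmem
    obtain ⟨f, hf, -⟩ := exists_mem_weakDerived t hε4 (fun p q y hy => (ht p q y hy).1)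
      (fun f η hη => by
        obtain ⟨n₀, hn₀⟩ := hF.exists_norm_lt f hη
        exact ⟨n₀, fun n hn q y hy => hn₀ n hn q y (ht n q y hy).1 (ht n q y hy).2⟩) M _ ∅ hmem
    -- The fourth of `δ = ε / 4` comes from `exists_mem_weakDerived`, the factor `2` from the
    -- passage to sequential derivatives.
    have h2 : ε / 4 / 4 = 2 * (ε / 32) := by ring
    rw [h2] at hf
    have hf1 : f ∈ weakDerived 𝕜 X (2 * (ε / 32)) (0 + 1) :=
      weakDerived_anti (by rw [zero_add]; exact Order.one_le_iff_pos.2 (opow_pos α omega0_pos)) hf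
    have h1 := weakDerived_subset_szlenkDerived (ε / 32) _ f hf1
    rw [szlenkDerived_add_one, szlenkDerived_zero] at h1
    exact absurd (opow_lt_szlenkIndex (by positivity) hα (mem_weakDerived.1 hf).1
      (weakDerived_subset_szlenkDerived (ε / 32) _ f hf) ⟨_, h1⟩) hSz.not_gt
  obtain ⟨N, hNM, hN, hsum⟩ := exists_infinite_sum_lt hlam hα (isHereditary_normingFamily t (ε / 4))
    hM hrank (half_pos hε)
  refine ⟨N, hNM, hN, fun B _ hBN x hx hran => ?_⟩
  rcases sum_schreierZeta_smul (𝕜 := 𝕜) lam α B x with h0 | ⟨C, z, D, hz, hDC, hDB, heq⟩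
  · rw [h0, norm_zero]
    exact hε
  rw [heq]
  obtain ⟨g, hg, hgv⟩ := exists_dual_vector'' 𝕜 (∑ b ∈ D, (z b : 𝕜) • x b)
  have hle : ∀ v : X, ‖g v‖ ≤ ‖v‖ := fun v =>
    (g.le_opNorm v).trans (mul_le_of_le_one_left (norm_nonneg v) hg)
  -- With threshold `ε / 2` and nets of mesh `ε / 4`, the functional `g` is still at least `ε / 4`
  -- on the approximating net vectors.
  set A := D.filter fun b => ε / 2 ≤ ‖g (x b)‖ with hA
  have hAF : A ∈ normingFamily 𝕜 t (ε / 4) := by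
    refine ⟨StrongDual.toWeakDual g, mem_closedBall_zero_iff.2 hg, fun p hp a ha q hq hpa haq => ?_⟩
    rw [hA, Finset.mem_filter] at hp ha hq
    obtain ⟨y, hy, hxy⟩ := htnet p q (x a) (hx a (hDB ha.1)) fun n hn =>
      ⟨(hran a (hDB ha.1) hn).1 p (hDB hp.1) hpa, (hran a (hDB ha.1) hn).2 q (hDB hq.1) haq⟩
    refine ⟨y, hy, ?_⟩
    change ε / 4 ≤ ‖g y‖
    have h1 := hle (x a - y)
    rw [map_sub] at h1
    linarith [norm_sub_norm_le (g (x a)) (g y), ha.2]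
  have hlt := hsum C z D A hz hDC ((Finset.coe_subset.2 hDB).trans hBN) (Finset.filter_subset _ _)
    hAF
  have hz0 := hz.properties.2.2.1
  have hterm : ∀ b ∈ D, ‖g ((z b : 𝕜) • x b)‖ ≤
      z b * (ε / 2) + if ε / 2 ≤ ‖g (x b)‖ then z b else 0 := by
    intro b hb
    rw [map_smul, norm_smul, RCLike.norm_ofReal, abs_of_nonneg (hz0 b)]
    split_ifs with h
    · have h1 := (hle (x b)).trans (hx b (hDB hb))
      have h2 := mul_le_of_le_one_right (hz0 b) h1
      have h3 := mul_nonneg (hz0 b) (half_pos hε).le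
      linarith
    · rw [add_zero]
      exact mul_le_mul_of_nonneg_left (not_le.1 h).le (hz0 b)
  have hnorm : ‖∑ b ∈ D, (z b : 𝕜) • x b‖ = ‖g (∑ b ∈ D, (z b : 𝕜) • x b)‖ := by
    rw [hgv, RCLike.norm_ofReal, abs_norm]
  calc ‖∑ b ∈ D, (z b : 𝕜) • x b‖ ≤ ∑ b ∈ D, ‖g ((z b : 𝕜) • x b)‖ := by
        rw [hnorm, map_sum]
        exact norm_sum_le _ _
    _ ≤ (∑ b ∈ D, z b) * (ε / 2) + ∑ b ∈ A, z b := by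
        rw [Finset.sum_mul, hA, Finset.sum_filter, ← Finset.sum_add_distrib]
        exact Finset.sum_le_sum hterm
    _ < 1 * (ε / 2) + ε / 2 :=
        add_lt_add_of_le_of_lt
          (mul_le_mul_of_nonneg_right hz.sum_le_one (half_pos hε).le) hlt
    _ = ε := by ring
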